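/- A hypergraph $\mathcal H=(V,E)$ has a finite vertex set $V$ and a set $E$ of non-empty subsets of $V$ as edges; it is $r$-uniform if every edge has exactly $r$ elements. Its chromatic number $\chi(\mathcal H)$ is the least $m$ for which there is a map $V\to\{1,\dots,m\}$ that is constant on no edge. The categorical product $\mathcal H_1\times\mathcal H_2$ has vertex set $V(\mathcal H_1)\times V(\mathcal H_2)$ and as edges all sets $\{(u_1,v_1),\dots,(u_s,v_s)\}$, $s\ge 1$, with $\{u_1,\dots,u_s\}\in E(\mathcal H_1)$ and $\{v_1,\dots,v_s\}\in E(\mathcal H_2)$. For an $r$-uniform hypergraph $\mathcal H$, the Alon–Frankl–Lovász complex $B_{\mathrm{edge}}(\mathcal H)$ is the simplicial complex whose vertices are the ordered $r$-tuples $(u_1,\dots,u_r)$ with $\{u_1,\dots,u_r\}\in E(\mathcal H)$. For a set $T$ of vertices let $\pi_i(T)$ be the set of $i$-th coordinates of its elements; a non-empty set $T$ is a simplex if $\pi_1(T),\dots,\pi_r(T)$ are pairwise disjoint and $\{x_1,\dots,x_r\}\in E(\mathcal H)$ for every choice of $x_i\in\pi_i(T)$. The group $\mathbb Z/r$ acts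 on it by cyclic shift of the coordinates, and $\|B_{\mathrm{edge}}(\mathcal H)\|$ denotes the geometric realization with the induced action. For a space $X$ with an action of a finite group $G$, the mapping co-index $\operatorname{coind}X$ is the maximal integer $k\ge -1$ for which there is a $G$-equivariant continuous map $E_kG\to X$, where $E_kG=G*\cdots*G$ ($k+1$ copies of the discrete space $G$) and $E_{-1}G=\emptyset$. Let $p$ be a prime number. (1) Let $\mathcal H_1,\mathcal H_2$ be $p$-uniform hypergraphs with non-empty vertex sets. Then the maxima defining $\operatorname{coind}\|B_{\mathrm{edge}}(\mathcal H_i)\|$ ($i=1,2$, with $G=\mathbb Z/p$) exist and $$\chi(\mathcal H_1\times\mathcal H_2)\ \ge\ 1+\left\lceil\frac{\min\{\operatorname{coind}\|B_{\mathrm{edge}}(\mathcal H_1)\|,\ \operatorname{coind}\|B_{\mathrm{edge}}(\mathcal H_2)\|\}+1}{p-1}\right\rceil .$$ (2) Consequently, if $\mathcal H_1,\mathcal H_2$ are $p$-uniform hypergraphs with $\chi(\mathcal H_i)=1+\left\lceil\frac{\operatorname{coind}\|B_{\mathrm{edge}}(\mathcal H_i)\|+1}{p-1}\right\rceil$ for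 $i=1,2$, then they satisfy Zhu's conjecture: $\chi(\mathcal H_1\times\mathcal H_2)=\min\{\chi(\mathcal H_1),\chi(\mathcal H_2)\}$. (3) In particular, for all non-negative integers $n_1,k_1,n_2,k_2$, the Kneser hypergraphs $\mathrm{KG}^p(n_1,k_1)$ and $\mathrm{KG}^p(n_2,k_2)$ satisfy Zhu's conjecture: $\chi(\mathrm{KG}^p(n_1,k_1)\times\mathrm{KG}^p(n_2,k_2))=\min\{\chi(\mathrm{KG}^p(n_1,k_1)),\chi(\mathrm{KG}^p(n_2,k_2))\}$. Here $\mathrm{KG}^p(n,k)$ is the $p$-uniform hypergraph whose vertices are the $k$-element subsets of $\{1,\dots,n\}$ and whose edges are the sets of $p$ pairwise disjoint vertices. -/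

import Mathlib

open scoped Hypergraph

noncomputable section

namespace Hypergraph

/-- `H` is `r`-uniform: every edge has exactly `r` elements. -/
def IsUniform {α : Type*} (H : Hypergraph α) (r : ℕ) : Prop :=
  ∀ e ∈ E(H), e.Finite ∧ e.ncard = r

/-- `H` has a proper `m`-coloring: a map from the vertices to `m` colors for which no edge is
monochromatic, that is, every edge receives at least two colors. -/
def Colorable {α : Type*} (H : Hypergraph α) (m : ℕ) : Prop :=
  ∃ c : V(H) → Fin m, ∀ e ∈ E(H), ∃ x y : V(H), x.1 ∈ e ∧ y.1 ∈ e ∧ c x ≠ c y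

/-- The chromatic number: the least `m` such that `H` is `m`-colorable. (Every hypergraph with
finitely many vertices all of whose edges have at least two elements is `m`-colorable for
some `m`.) -/
def chromaticNumber {α : Type*} (H : Hypergraph α) : ℕ :=
  sInf {m | H.Colorable m}

/-- The categorical product. Its edges are the sets `{(u₁, v₁), …, (uₛ, vₛ)}` such that
`{u₁, …, uₛ}` is an edge of `H₁` and `{v₁, …, vₛ}` is an edge of `H₂`. -/
def prod {α β : Type*} (H₁ : Hypergraph α) (H₂ : Hypergraph β) : Hypergraph (α × β) where
  vertexSet := V(H₁) ×ˢ V(H₂)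
  edgeSet := {e | Prod.fst '' e ∈ E(H₁) ∧ Prod.snd '' e ∈ E(H₂)}
  subset_vertexSet_of_mem_edgeSet' := fun _ he _ hx =>
    ⟨H₁.subset_vertexSet_of_mem_edgeSet' he.1 (Set.mem_image_of_mem _ hx),
      H₂.subset_vertexSet_of_mem_edgeSet' he.2 (Set.mem_image_of_mem _ hx)⟩

/-- The Kneser `r`-uniform hypergraph: its vertices are the `k`-element subsets of an `n`-element
set, and its edges are the sets of `r` pairwise disjoint vertices. -/
def kneser (r n k : ℕ) : Hypergraph (Finset (Fin n)) where
  vertexSet := {A | A.card = k}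
  edgeSet := {e | e ⊆ {A | A.card = k} ∧ e.ncard = r ∧
    ∀ A ∈ e, ∀ B ∈ e, A ≠ B → Disjoint A B}
  subset_vertexSet_of_mem_edgeSet' := fun _ he => he.1

end Hypergraph

/-- The geometric realization of a simplicial complex with finitely many faces, in barycentric
coordinates, as a subspace of `ι → ℝ`: nonnegative functions with total mass `1`
whose support lies in a face. -/
def geometricRealization {ι : Type*} (K : PreAbstractSimplicialComplex ι) : Set (ι → ℝ) :=
  {x | (∀ i, 0 ≤ x i) ∧ ∃ s ∈ K.faces, (∀ i, i ∉ s → x i = 0) ∧ ∑ i ∈ s, x i = 1}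

/-- A simplicial complex together with a simplicial action of the group `G`: the group acts on
(the ambient type of) the vertices and takes faces to faces. -/
structure GSimplicialComplex (G ι : Type*) [Group G] [MulAction G ι] extends
    PreAbstractSimplicialComplex ι where
  smul_mem : ∀ (g : G) (s : Finset ι), s ∈ faces →
    s.map (MulAction.toPerm g).toEmbedding ∈ faces

namespace GSimplicialComplex

variable {G ι : Type*} [Group G] [MulAction G ι]

/-- The polyhedron `‖K‖`. -/
abbrev Space (K : GSimplicialComplex G ι) : Type _ :=
  ↥(geometricRealization K.toPreAbstractSimplicialComplex)

/-- The action of `G` on the polyhedron: the affine extension of the action on vertices. -/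
instance (K : GSimplicialComplex G ι) : MulAction G K.Space where
  smul g x := ⟨fun i => x.1 (g⁻¹ • i), by
    obtain ⟨h0, s, hs, hsupp, hsum⟩ := x.2
    refine ⟨fun i => h0 _, _, K.smul_mem g s hs, fun i hi => hsupp _ fun h => hi ?_, ?_⟩
    · exact Finset.mem_map.2 ⟨g⁻¹ • i, h, by simp⟩
    · simpa using hsum⟩
  one_smul x := by
    apply Subtype.ext
    funext i
    change x.1 ((1 : G)⁻¹ • i) = x.1 i
    simp
  mul_smul g h x := by
    apply Subtype.ext
    funext i
    change x.1 ((g * h)⁻¹ • i) = x.1 (h⁻¹ • (g⁻¹ • i))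
    rw [mul_inv_rev, mul_smul]

end GSimplicialComplex

/-- The vertices of the `n`-fold join `G * ⋯ * G`: pairs of a join factor and a group element,
with `G` acting by left multiplication in each factor. -/
structure JoinVertex (G : Type*) (n : ℕ) where
  level : Fin n
  elt : G

instance (G : Type*) [Group G] (n : ℕ) : MulAction G (JoinVertex G n) where
  smul g v := ⟨v.level, g * v.elt⟩
  one_smul v := by
    change JoinVertex.mk v.level (1 * v.elt) = v
    rw [one_mul]
  mul_smul g h v := by
    change JoinVertex.mk v.level (g * h * v.elt) = JoinVertex.mk v.level (g * (h * v.elt))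
    rw [mul_assoc]

/-- The `n`-fold join `G * ⋯ * G` of the discrete space `G`, as a simplicial complex: a face is a
nonempty set of vertices with at most one vertex in each of the `n` factors. Its polyhedron for
`n = k + 1` is `E_k G`; for `n = 0` it is empty. -/
def joinPower (G : Type*) [Group G] (n : ℕ) : GSimplicialComplex G (JoinVertex G n) where
  faces := {s | s.Nonempty ∧ ∀ v ∈ s, ∀ w ∈ s, v.level = w.level → v = w}
  isRelLowerSet_faces := fun _ hs =>
    ⟨hs.1, fun _ hts ht => ⟨ht, fun v hv w hw => hs.2 v (hts hv) w (hts hw)⟩⟩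
  smul_mem := by
    rintro g s ⟨hne, hs⟩
    refine ⟨hne.map, fun v hv w hw h => ?_⟩
    obtain ⟨v', hv', rfl⟩ := Finset.mem_map.1 hv
    obtain ⟨w', hw', rfl⟩ := Finset.mem_map.1 hw
    rw [hs v' hv' w' hw' h]

/-- The set of all integers `k ≥ -1` for which there is a `G`-equivariant continuous map
`E_k G → X`, where `E_k G` is the join of `k + 1` copies of `G` and `E_{-1} G` is empty. -/
def coindSet (G X : Type*) [Group G] [TopologicalSpace X] [MulAction G X] : Set ℤ :=
  {k | ∃ n : ℕ, k = (n : ℤ) - 1 ∧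
    ∃ f : C((joinPower G n).Space, X), ∀ (g : G) (x : (joinPower G n).Space), f (g • x) = g • f x}

/-- The mapping co-index of a `G`-space: the maximal `k` such that there is a `G`-equivariant map
`E_k G → X`. -/
def coind (G X : Type*) [Group G] [TopologicalSpace X] [MulAction G X] : ℤ :=
  sSup (coindSet G X)

/-- Ordered `r`-tuples of elements of `α`, with positions indexed by `ℤ/r`. -/
structure Tuple (r : ℕ) (α : Type*) where
  coord : ZMod r → α

/-- The cyclic group `ℤ/r` acts on `r`-tuples by cyclic shift. -/
instance (r : ℕ) (α : Type*) : MulAction (Multiplicative (ZMod r)) (Tuple r α) where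
  smul g u := ⟨fun i => u.coord (i + g.toAdd)⟩
  one_smul u := by
    change Tuple.mk (fun i => u.coord (i + 0)) = u
    simp
  mul_smul g h u := by
    change Tuple.mk (fun i => u.coord (i + (g.toAdd + h.toAdd))) =
      Tuple.mk (fun i => u.coord (i + g.toAdd + h.toAdd))
    simp [add_assoc]

/-- `π_i(T)`, the set of `i`-th coordinates of the tuples in `T`. -/
def coordImage {r : ℕ} {α : Type*} (i : ZMod r) (T : Finset (Tuple r α)) : Set α :=
  (fun u => u.coord i) '' (T : Set (Tuple r α))

/-- The Alon–Frankl–Lovász complex `B_edge(H)` of an `r`-uniform hypergraph, with the cyclic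
shift action of `ℤ/r`. Its vertices are the ordered `r`-tuples whose entries form an edge of `H`;
a nonempty finite set `T` of vertices is a face if the sets `π_i(T)` are pairwise disjoint and any
choice of one element from each of them gives an edge of `H`. -/
def bEdge (r : ℕ) {α : Type*} (H : Hypergraph α) :
    GSimplicialComplex (Multiplicative (ZMod r)) (Tuple r α) where
  faces := {T | T.Nonempty ∧ (∀ u ∈ T, Set.range u.coord ∈ E(H)) ∧
    (∀ i j, i ≠ j → Disjoint (coordImage i T) (coordImage j T)) ∧
    ∀ x : ZMod r → α, (∀ i, x i ∈ coordImage i T) → Set.range x ∈ E(H)}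
  isRelLowerSet_faces := by
    rintro T ⟨hne, hv, hd, he⟩
    refine ⟨hne, fun S hST hS => ⟨hS, fun u hu => hv u (hST hu), fun i j hij => ?_,
      fun x hx => he x fun i => ?_⟩⟩
    · exact (hd i j hij).mono (Set.image_mono (Finset.coe_subset.2 hST))
        (Set.image_mono (Finset.coe_subset.2 hST))
    · exact Set.image_mono (Finset.coe_subset.2 hST) (hx i)
  smul_mem := by
    rintro g T ⟨hne, hv, hd, he⟩
    have himg : ∀ i, coordImage i (T.map (MulAction.toPerm g).toEmbedding) =
        coordImage (i + g.toAdd) T := by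
      intro i
      ext a
      constructor
      · rintro ⟨u, hu, rfl⟩
        obtain ⟨w, hw, rfl⟩ := Finset.mem_map.1 (Finset.mem_coe.1 hu)
        exact ⟨w, hw, rfl⟩
      · rintro ⟨w, hw, rfl⟩
        exact ⟨g • w, Finset.mem_coe.2 (Finset.mem_map.2 ⟨w, hw, rfl⟩), rfl⟩
    have hrange : ∀ x : ZMod r → α, Set.range (fun i => x (i + g.toAdd)) = Set.range x :=
      fun x => (Equiv.addRight g.toAdd).surjective.range_comp x
    refine ⟨hne.map, fun u hu => ?_, fun i j hij => ?_, fun x hx => ?_⟩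
    · obtain ⟨w, hw, rfl⟩ := Finset.mem_map.1 hu
      change Set.range (fun i => w.coord (i + g.toAdd)) ∈ E(H)
      rw [hrange]
      exact hv w hw
    · rw [himg, himg]
      exact hd _ _ fun h => hij (add_right_cancel h)
    · have h := he (fun i => x (i - g.toAdd)) fun i => by
        have h := hx (i - g.toAdd)
        rw [himg, sub_add_cancel] at h
        exact h
      rw [← hrange] at h
      simpa using h

/-- `coind ‖B_edge(H)‖`, with respect to the cyclic shift action of `ℤ/p`. -/
def coindBEdge (p : ℕ) {α : Type*} (H : Hypergraph α) : ℤ :=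
  coind (Multiplicative (ZMod p)) (bEdge p H).Space

end

/-! The lower bound is a Borsuk–Ulam argument. Let `c` color the product with `m + 1` colors, and
let two equivariant maps send the `n`-fold join of `ℤ/p` to the two complexes. Barycentric
coordinates of tuples are weights. For each `x`, a matrix records for color `j` and column `i` the
total weight of the pairs `(u, v)` of tuples with `c (u (-i), v (-i)) = j`. Columns have sum `1`,
and the group permutes them cyclically. If all columns agreed, some color would occur in every
column; the face condition of the complexes makes the diagonal entries of the tuples found there
edges of both factors, so their pairs would form a monochromatic edge. Hence columns never all
agree, and `le_of_equivariant_matrix` gives `n ≤ m * (p - 1)`. With equal factors this also bounds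
each co-index.

That Borsuk–Ulam theorem and the Kneser case both follow from a `ℤ/p`-Tucker lemma,
`IsTower.false_of_label`. A tower is the image of the standard resolution of `ℤ/p` in the chains of
a space with `ℤ/p`-action. An equivariant labelling of faces, composed with barycentric subdivision,
carries it to ordered chains on the vertex set `ℤ/p`, where explicit invariant cocycles take the
value `1` on it (`IsTower.eval_eq_one`). If labels along flags change only when the level does and
there are at most `n - 1` levels, every flag of `n` faces repeats a label at consecutive places. The
cocycles vanish on such degenerate simplices, so `1 = 0`.

For Kneser hypergraphs no co-index is computed. `le_mul_of_coloring` labels the sign vectors on both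
ground sets at once and applies the Tucker lemma directly; the greedy coloring supplies the matching
upper bound. The inequality `χ(H₁ × H₂) ≤ min` holds because a coloring of a factor pulls back. -/

namespace ListChain

/-! ### Augmented ordered chains and barycentric subdivision. -/

section Chains

variable {R : Type*} [CommRing R] {A B : Type*}

/-- Prepending a vertex to an ordered chain. -/
noncomputable def cone (a : A) : (List A →₀ R) →ₗ[R] (List A →₀ R) :=
  Finsupp.lmapDomain R R (List.cons a)

/-- The augmented boundary of an ordered simplex. -/
noncomputable def bdList : List A → (List A →₀ R)
  | [] => 0
  | a :: l => Finsupp.single l 1 - cone a (bdList l)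

/-- The augmented boundary of an ordered chain. -/
noncomputable def bd : (List A →₀ R) →ₗ[R] (List A →₀ R) :=
  Finsupp.linearCombination R bdList

/-- The chain map induced by a map of vertices. -/
noncomputable def mapChain (f : A → B) : (List A →₀ R) →ₗ[R] (List B →₀ R) :=
  Finsupp.lmapDomain R R (List.map f)

/-- The barycentric subdivision in which `b l` is the new vertex in the simplex `l`. -/
noncomputable def sd (b : List A → B) : ℕ → (List A →₀ R) →ₗ[R] (List B →₀ R)
  | 0 => Finsupp.linearCombination R fun _ => Finsupp.single [] 1
  | n + 1 => Finsupp.linearCombination R fun l => cone (b l) (sd b n (bdList l))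

@[simp] theorem cone_single (a : A) (l : List A) (r : R) :
    cone a (Finsupp.single l r) = Finsupp.single (a :: l) r := by
  simp [cone, Finsupp.lmapDomain_apply, Finsupp.mapDomain_single]

@[simp] theorem mapChain_single (f : A → B) (l : List A) (r : R) :
    mapChain f (Finsupp.single l r) = Finsupp.single (l.map f) r := by
  simp [mapChain, Finsupp.lmapDomain_apply, Finsupp.mapDomain_single]

theorem bd_single (l : List A) : bd (Finsupp.single l (1 : R)) = bdList l := by
  simp [bd]

theorem linearMap_ext {M : Type*} [AddCommGroup M] [Module R M] {φ ψ : (List A →₀ R) →ₗ[R] M}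
    (h : ∀ l, φ (Finsupp.single l 1) = ψ (Finsupp.single l 1)) (c : List A →₀ R) : φ c = ψ c := by
  have : φ = ψ := Finsupp.lhom_ext' fun l => LinearMap.ext_ring (h l)
  rw [this]

theorem bd_cone (a : A) (c : List A →₀ R) : bd (cone a c) = c - cone a (bd c) := by
  refine linearMap_ext (φ := bd ∘ₗ cone a) (ψ := LinearMap.id - cone a ∘ₗ bd) (fun l => ?_) c
  simp [bd_single, bdList]

theorem bd_bdList : ∀ l : List A, bd (bdList l : List A →₀ R) = 0
  | [] => by simp [bdList]
  | a :: l => by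
    rw [bdList, map_sub, bd_single, bd_cone, bd_bdList l, map_zero, sub_zero, sub_self]

theorem mapChain_cone (f : A → B) (a : A) (c : List A →₀ R) :
    mapChain f (cone a c) = cone (f a) (mapChain f c) :=
  linearMap_ext (φ := mapChain f ∘ₗ cone a) (ψ := cone (f a) ∘ₗ mapChain f) (fun l => by simp) c

theorem mapChain_bdList (f : A → B) : ∀ l : List A,
    mapChain f (bdList l : List A →₀ R) = bdList (l.map f)
  | [] => by simp [bdList]
  | a :: l => by
    rw [bdList, map_sub, mapChain_cone, mapChain_bdList f l]
    simp [bdList]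

theorem mapChain_bd (f : A → B) (c : List A →₀ R) : mapChain f (bd c) = bd (mapChain f c) :=
  linearMap_ext (φ := mapChain f ∘ₗ bd) (ψ := bd ∘ₗ mapChain f)
    (fun l => by simp [bd_single, mapChain_bdList]) c

theorem mapChain_mapChain {C : Type*} (g : B → C) (f : A → B) (c : List A →₀ R) :
    mapChain g (mapChain f c) = mapChain (g ∘ f) c :=
  linearMap_ext (φ := mapChain g ∘ₗ mapChain f) (ψ := mapChain (g ∘ f)) (fun l => by simp) c

theorem sd_zero_nil (b : List A → B) :
    sd b 0 (Finsupp.single [] (1 : R)) = Finsupp.single [] 1 := by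
  simp [sd]

theorem sd_succ_single (b : List A → B) (n : ℕ) (l : List A) :
    sd b (n + 1) (Finsupp.single l (1 : R)) = cone (b l) (sd b n (bdList l)) := by
  simp [sd]

/-- By the cone formula, the error term is a cone over a subdivided double boundary, which is zero.
In degree zero it vanishes because the image lies on the empty simplex. No restriction on the
lengths of the simplices is needed. -/
theorem bd_sd (b : List A → B) : ∀ (n : ℕ) (c : List A →₀ R),
    bd (sd b (n + 1) c) = sd b n (bd c)
  | 0, c => by
    refine linearMap_ext (φ := bd ∘ₗ sd b 1) (ψ := sd b 0 ∘ₗ bd) (fun l => ?_) c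
    have h : ∀ c : List A →₀ R, bd (sd b 0 c) = 0 :=
      fun c => linearMap_ext (φ := bd ∘ₗ sd b 0) (ψ := 0)
        (fun l => by simp [sd, bd_single, bdList]) c
    rw [LinearMap.comp_apply, LinearMap.comp_apply, sd_succ_single, bd_cone, h, bd_single]
    simp
  | n + 1, c => by
    refine linearMap_ext (φ := bd ∘ₗ sd b (n + 2)) (ψ := sd b (n + 1) ∘ₗ bd) (fun l => ?_) c
    rw [LinearMap.comp_apply, LinearMap.comp_apply, sd_succ_single, bd_cone, bd_sd b n,
      bd_bdList, bd_single]
    simp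

theorem map_mem_supported {F : Set (List A)} {F' : Set (List B)}
    {φ : (List A →₀ R) →ₗ[R] (List B →₀ R)}
    (h : ∀ l ∈ F, φ (Finsupp.single l 1) ∈ Finsupp.supported R R F') {c : List A →₀ R}
    (hc : c ∈ Finsupp.supported R R F) : φ c ∈ Finsupp.supported R R F' := by
  rw [Finsupp.supported_eq_span_single] at hc
  have : Submodule.span R ((fun l => Finsupp.single l (1 : R)) '' F) ≤
      (Finsupp.supported R R F').comap φ := by
    rw [Submodule.span_le]
    rintro _ ⟨l, hl, rfl⟩
    exact h l hl
  exact this hc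

theorem eq_of_mem_supported {M : Type*} [AddCommGroup M] [Module R M] {F : Set (List A)}
    {φ ψ : (List A →₀ R) →ₗ[R] M}
    (h : ∀ l ∈ F, φ (Finsupp.single l 1) = ψ (Finsupp.single l 1)) {c : List A →₀ R}
    (hc : c ∈ Finsupp.supported R R F) : φ c = ψ c := by
  rw [Finsupp.supported_eq_span_single] at hc
  have : Set.EqOn φ ψ (Submodule.span R ((fun l => Finsupp.single l (1 : R)) '' F)) := by
    apply LinearMap.eqOn_span
    rintro _ ⟨l, hl, rfl⟩
    exact h l hl
  exact this hc

theorem bdList_mem_supported : ∀ l : List A, (bdList l : List A →₀ R) ∈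
    Finsupp.supported R R {l' | l'.Sublist l ∧ l'.length + 1 = l.length}
  | [] => by simp [bdList]
  | a :: l => by
    rw [bdList]
    refine Submodule.sub_mem _ (Finsupp.single_mem_supported _ _ (by simp)) ?_
    refine map_mem_supported (fun l' hl' => ?_) (bdList_mem_supported l)
    rw [cone_single]
    exact Finsupp.single_mem_supported _ _ ⟨hl'.1.cons_cons a, by simp [hl'.2]⟩

theorem sd_mapChain {A' B' : Type*} {b : List A → B} {b' : List A' → B'} {f : A → A'} {g : B → B'}
    {F : Set (List A)} (hF : ∀ l ∈ F, ∀ l', l'.Sublist l → l' ∈ F)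
    (hb : ∀ l ∈ F, l ≠ [] → b' (l.map f) = g (b l)) : ∀ (n : ℕ) {c : List A →₀ R},
    c ∈ Finsupp.supported R R F → sd b' n (mapChain f c) = mapChain g (sd b n c)
  | 0, c, _ => linearMap_ext (φ := sd b' 0 ∘ₗ mapChain f) (ψ := mapChain g ∘ₗ sd b 0)
      (fun l => by simp [sd]) c
  | n + 1, c, hc => by
    refine eq_of_mem_supported (φ := sd b' (n + 1) ∘ₗ mapChain f)
      (ψ := mapChain g ∘ₗ sd b (n + 1)) (fun l hl => ?_) hc
    rw [LinearMap.comp_apply, LinearMap.comp_apply, mapChain_single, sd_succ_single,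
      sd_succ_single, mapChain_cone, ← mapChain_bdList]
    rcases eq_or_ne l [] with rfl | hne
    · simp [bdList]
    · rw [hb l hl hne, sd_mapChain hF hb n]
      exact Finsupp.supported_mono (fun l' hl' => hF l hl l' hl'.1) (bdList_mem_supported l)

/-- Subdivided simplices come from flags of faces, listed from the largest face down. -/
theorem sd_mem_supported (b : List A → B) : ∀ (n : ℕ) (l : List A), l.length = n →
    sd b n (Finsupp.single l (1 : R)) ∈ Finsupp.supported R R
      {q | ∃ L : List (List A), q = L.map b ∧ L.length = n ∧
        L.Pairwise (fun s s' => s'.Sublist s) ∧ ∀ s ∈ L, s.Sublist l ∧ s ≠ []}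
  | 0, l, _ => by
    simp only [sd, Finsupp.linearCombination_single, one_smul]
    exact Finsupp.single_mem_supported _ _ ⟨[], by simp⟩
  | n + 1, l, hl => by
    rw [sd_succ_single]
    refine map_mem_supported (F := {q | ∃ L : List (List A), q = L.map b ∧ L.length = n ∧
        L.Pairwise (fun s s' => s'.Sublist s) ∧ ∀ s ∈ L, s.Sublist l ∧ s ≠ []})
      (fun q hq => ?_) (map_mem_supported (fun l' hl' => ?_) (bdList_mem_supported l))
    · obtain ⟨L, rfl, hL, hP, hs⟩ := hq
      rw [cone_single]
      refine Finsupp.single_mem_supported _ _ ⟨l :: L, by simp, by simp [hL], ?_, ?_⟩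
      · exact List.pairwise_cons.2 ⟨fun s h => (hs s h).1, hP⟩
      · intro s h
        rcases List.mem_cons.1 h with rfl | h
        · exact ⟨List.Sublist.refl _, by rintro rfl; simp at hl⟩
        · exact hs s h
    · refine Finsupp.supported_mono ?_ (sd_mem_supported b n l' (by have := hl'.2; omega))
      rintro q ⟨L, hq, hL, hP, hs⟩
      exact ⟨L, hq, hL, hP, fun s h => ⟨(hs s h).1.trans hl'.1, (hs s h).2⟩⟩

end Chains

/-! ### Explicit invariant cocycles on the ordered simplices of `ℤ/p`. -/

section Cocycle

variable {p : ℕ}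

/-- The indicator of a descent of canonical representatives. -/
def descent (a b : ZMod p) : ZMod p := if b.val < a.val then 1 else 0

/-- The carry cocycle, which represents the Bockstein class. -/
def carry (a b c : ZMod p) : ZMod p := descent a b + descent b c - descent a c

/-- The invariant cocycle on the ordered simplices of even dimension: a cup power of `carry`. -/
def evenCocycle : List (ZMod p) → ZMod p
  | [] => 0
  | [_] => 1
  | [_, _] => 0
  | a :: b :: c :: r => carry a b c * evenCocycle (c :: r)

/-- The invariant cocycle on the ordered simplices of odd dimension. -/
def oddCocycle : List (ZMod p) → ZMod p
  | a :: b :: r => (b - a) * evenCocycle (b :: r)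
  | _ => 0

/-- A cochain with coboundary `oddCocycle`. -/
def oddPrimitive : List (ZMod p) → ZMod p
  | [] => 0
  | a :: r => a * evenCocycle (a :: r)

/-- A cochain with coboundary `evenCocycle`, in positive dimensions. -/
def evenPrimitive : List (ZMod p) → ZMod p
  | a :: b :: r => descent a b * evenCocycle (b :: r)
  | _ => 0

/-- The value of a cochain on a chain. -/
noncomputable def eval (z : List (ZMod p) → ZMod p) : (List (ZMod p) →₀ ZMod p) →ₗ[ZMod p] ZMod p :=
  Finsupp.linearCombination (ZMod p) z

@[simp] theorem eval_single (z : List (ZMod p) → ZMod p) (l : List (ZMod p)) :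
    eval z (Finsupp.single l 1) = z l := by
  simp [eval]

theorem eval_evenCocycle_cone (a b c : ZMod p) (x : List (ZMod p) →₀ ZMod p) :
    eval evenCocycle (cone a (cone b (cone c x))) = carry a b c * eval evenCocycle (cone c x) :=
  linearMap_ext (φ := eval evenCocycle ∘ₗ cone a ∘ₗ cone b ∘ₗ cone c)
    (ψ := carry a b c • (eval evenCocycle ∘ₗ cone c)) (fun l => by simp [evenCocycle]) x

/-- A cup product of cocycles is a cocycle. The recursion removes one factor `carry`, hence two
vertices, at a time; `hc` is the cocycle identity of `carry`. -/
theorem eval_evenCocycle_bdList : ∀ l : List (ZMod p), eval evenCocycle (bdList l) = 0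
  | [] => by simp [bdList]
  | [_] => by simp [bdList, evenCocycle]
  | [_, _] => by simp [bdList, evenCocycle]
  | [_, _, _] => by simp [bdList, evenCocycle]
  | a :: b :: c :: d :: r => by
    have ih := eval_evenCocycle_bdList (c :: d :: r)
    simp only [bdList, map_sub, cone_single, eval_single, eval_evenCocycle_cone, evenCocycle]
      at ih ⊢
    have hc : carry b c d - carry a c d + carry a b d - carry a b c = 0 := by
      simp only [carry]; ring
    linear_combination evenCocycle (d :: r) * hc + carry a b c * ih

theorem eval_oddPrimitive_cone (a : ZMod p) (x : List (ZMod p) →₀ ZMod p) :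
    eval oddPrimitive (cone a x) = a * eval evenCocycle (cone a x) :=
  linearMap_ext (φ := eval oddPrimitive ∘ₗ cone a)
    (ψ := a • (eval evenCocycle ∘ₗ cone a)) (fun l => by simp [oddPrimitive]) x

theorem eval_evenPrimitive_cone (a b : ZMod p) (x : List (ZMod p) →₀ ZMod p) :
    eval evenPrimitive (cone a (cone b x)) = descent a b * eval evenCocycle (cone b x) :=
  linearMap_ext (φ := eval evenPrimitive ∘ₗ cone a ∘ₗ cone b)
    (ψ := descent a b • (eval evenCocycle ∘ₗ cone b)) (fun l => by simp [evenPrimitive]) x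

theorem eval_oddPrimitive_bdList : ∀ l : List (ZMod p),
    eval oddPrimitive (bdList l) = oddCocycle l
  | [] => by simp [bdList, oddCocycle]
  | [_] => by simp [bdList, oddPrimitive, oddCocycle]
  | a :: b :: r => by
    have h := eval_evenCocycle_bdList (a :: b :: r)
    simp only [bdList, map_sub, cone_single, eval_single, eval_oddPrimitive_cone, oddCocycle,
      oddPrimitive] at h ⊢
    linear_combination a * h

theorem eval_evenPrimitive_bdList : ∀ l : List (ZMod p), l.length ≠ 1 →
    eval evenPrimitive (bdList l) = evenCocycle l
  | [], _ => by simp [bdList, evenCocycle]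
  | [_], h => by simp at h
  | [_, _], _ => by simp [bdList, evenPrimitive, evenCocycle]
  | a :: b :: c :: r, _ => by
    have h := eval_evenCocycle_bdList (b :: c :: r)
    simp only [bdList, map_sub, cone_single, eval_single, eval_evenPrimitive_cone, evenCocycle,
      evenPrimitive, carry] at h ⊢
    linear_combination (-descent a b) * h

theorem val_sub_eq_descent [NeZero p] (a b : ZMod p) :
    ((b - a).val : ℤ) = b.val - a.val + p * (if b.val < a.val then 1 else 0) := by
  split_ifs with h
  · have hb := ZMod.val_sub h.le
    have h1 : b - a = -(a - b) := by ring
    have hne : a - b ≠ 0 := fun h0 => by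
      rw [sub_eq_zero] at h0; subst h0; exact lt_irrefl _ h
    rw [h1, ZMod.neg_val, if_neg hne, hb]
    have := ZMod.val_lt a
    omega
  · rw [ZMod.val_sub (not_lt.1 h)]
    omega

/-- Over the integers, `p` times the carry is a combination of representatives of differences, by
`val_sub_eq_descent`, and differences ignore translation. Dividing by `p` must precede reduction mod
`p`. The cochain `descent` itself is not invariant, so `carry` need not bound invariantly. -/
theorem carry_add [NeZero p] (a b c t : ZMod p) : carry (a + t) (b + t) (c + t) = carry a b c := by
  have key : ∀ x y z : ZMod p,
      (p : ℤ) * ((if y.val < x.val then 1 else 0) + (if z.val < y.val then 1 else 0) -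
        (if z.val < x.val then 1 else 0)) = (y - x).val + (z - y).val - (z - x).val := by
    intro x y z
    rw [val_sub_eq_descent, val_sub_eq_descent, val_sub_eq_descent]
    ring
  have h := (key (a + t) (b + t) (c + t)).trans
    (by simp only [add_sub_add_right_eq_sub] : _ = ((b - a).val + (c - b).val - (c - a).val : ℤ))
  rw [← key a b c] at h
  have h2 := mul_left_cancel₀ (by exact_mod_cast NeZero.ne p) h
  have h3 := congrArg (fun z : ℤ => (z : ZMod p)) h2
  simpa [carry, descent] using h3

theorem evenCocycle_map_add [NeZero p] (t : ZMod p) : ∀ l : List (ZMod p),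
    evenCocycle (l.map (· + t)) = evenCocycle l
  | [] => rfl
  | [_] => rfl
  | [_, _] => rfl
  | a :: b :: c :: r => by
    have ih := evenCocycle_map_add t (c :: r)
    simp only [List.map_cons, evenCocycle, carry_add] at ih ⊢
    rw [ih]

/-- Summing `val_sub_eq_descent` over all translates cancels the representatives of `a + t` and `b +
t`, leaving `p` times that of `b - a`. This makes `oddCocycle` the norm of `evenPrimitive`. -/
theorem sum_descent_add [NeZero p] (a b : ZMod p) :
    ∑ t : ZMod p, descent (a + t) (b + t) = b - a := by
  have h : ∀ t : ZMod p, (p : ℤ) * (if (b + t).val < (a + t).val then 1 else 0) =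
      (b - a).val - (b + t).val + (a + t).val := by
    intro t
    have := val_sub_eq_descent (a + t) (b + t)
    rw [add_sub_add_right_eq_sub] at this
    linarith
  have hsum : (p : ℤ) * ∑ t : ZMod p, (if (b + t).val < (a + t).val then 1 else 0) =
      p * (b - a).val := by
    rw [Finset.mul_sum, Finset.sum_congr rfl fun t _ => h t, Finset.sum_add_distrib,
      Finset.sum_sub_distrib]
    have e : ∀ x : ZMod p, ∑ t : ZMod p, ((x + t).val : ℤ) = ∑ t : ZMod p, (t.val : ℤ) :=
      fun x => Equiv.sum_comp (Equiv.addLeft x) fun t : ZMod p => (t.val : ℤ)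
    rw [e, e, Finset.sum_const, Finset.card_univ, ZMod.card]
    simp
  have h2 := mul_left_cancel₀ (by exact_mod_cast NeZero.ne p) hsum
  have h3 := congrArg (fun z : ℤ => (z : ZMod p)) h2
  simpa [descent] using h3

theorem evenCocycle_eq_zero : ∀ l : List (ZMod p), ¬ l.IsChain (· ≠ ·) → evenCocycle l = 0
  | [], h => by simp at h
  | [_], h => by simp at h
  | [_, _], _ => rfl
  | a :: b :: c :: r, h => by
    rw [evenCocycle]
    by_cases h1 : a = b
    · subst h1; simp [carry, descent]
    by_cases h2 : b = c
    · subst h2; simp [carry, descent]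
    · rw [evenCocycle_eq_zero (c :: r), mul_zero]
      intro h3
      exact h (by simp [h1, h2, h3])

theorem oddCocycle_eq_zero : ∀ l : List (ZMod p), ¬ l.IsChain (· ≠ ·) → oddCocycle l = 0
  | [], h => by simp at h
  | [_], h => by simp at h
  | a :: b :: r, h => by
    rw [oddCocycle]
    by_cases h1 : a = b
    · subst h1; simp
    · rw [evenCocycle_eq_zero (b :: r), mul_zero]
      intro h3
      exact h (by simp [h1, h3])

end Cocycle

/-! ### Towers, their cohomological detection and the abstract Tucker lemma. -/

section Tower

variable {p : ℕ} [NeZero p] {A B : Type*}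

/-- Alternately the operators `τ - 1` and `1 + τ + ⋯ + τ ^ (p - 1)` of the group ring of `ℤ/p`. -/
noncomputable def resolutionMap (e : ZMod p → A → A) (i : ℕ) :
    (List A →₀ ZMod p) →ₗ[ZMod p] (List A →₀ ZMod p) :=
  if Odd i then mapChain (e 1) - LinearMap.id else ∑ t, mapChain (e t)

/-- A sequence of chains `h 0, …, h n` that defines a chain map from the standard resolution of
`ℤ/p`. The group acts by `e`, and `h i` has dimension `i - 1`. -/
structure IsTower (e : ZMod p → A → A) (n : ℕ) (h : ℕ → List A →₀ ZMod p) : Prop where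
  zero : h 0 = Finsupp.single [] 1
  one : bd (h 1) = h 0
  succ : ∀ i, 1 ≤ i → i < n → bd (h (i + 1)) = resolutionMap e i (h i)

theorem mapChain_resolutionMap {e : ZMod p → A → A} {e' : ZMod p → B → B} {f : A → B}
    (hf : ∀ t a, f (e t a) = e' t (f a)) (i : ℕ) (c : List A →₀ ZMod p) :
    mapChain f (resolutionMap e i c) = resolutionMap e' i (mapChain f c) := by
  have h : ∀ t, mapChain f (mapChain (e t) c) = mapChain (e' t) (mapChain f c) := fun t => by
    rw [mapChain_mapChain, mapChain_mapChain]
    congr 2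
    funext a
    exact hf t a
  unfold resolutionMap
  split_ifs
  · simp [h]
  · simp [h, LinearMap.sum_apply]

theorem IsTower.mapChain {e : ZMod p → A → A} {e' : ZMod p → B → B} {f : A → B}
    (hf : ∀ t a, f (e t a) = e' t (f a)) {n : ℕ} {h : ℕ → List A →₀ ZMod p} (H : IsTower e n h) :
    IsTower e' n fun i => ListChain.mapChain f (h i) where
  zero := by simp [H.zero]
  one := by rw [← mapChain_bd, H.one]
  succ i h1 hi := by rw [← mapChain_bd, H.succ i h1 hi, mapChain_resolutionMap hf]

theorem IsTower.sd {e : ZMod p → A → A} {e' : ZMod p → B → B} {b : List A → B}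
    {F : Set (List A)} (hF : ∀ l ∈ F, ∀ l', l'.Sublist l → l' ∈ F)
    (hb : ∀ t, ∀ l ∈ F, l ≠ [] → b (l.map (e t)) = e' t (b l)) {n : ℕ}
    {h : ℕ → List A →₀ ZMod p} (H : IsTower e n h)
    (hs : ∀ i ≤ n, h i ∈ Finsupp.supported (ZMod p) (ZMod p) F) :
    IsTower e' n fun i => ListChain.sd b i (h i) where
  zero := by rw [H.zero, sd_zero_nil]
  one := by rw [bd_sd, H.one]
  succ i h1 hi := by
    rw [bd_sd, H.succ i h1 hi]
    have key := fun t => sd_mapChain hF (hb t) i (hs i hi.le)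
    unfold resolutionMap
    split_ifs
    · simp [key]
    · simp [key, LinearMap.sum_apply]

theorem eval_resolutionMap_odd {i : ℕ} (hi : Odd i) (c : List (ZMod p) →₀ ZMod p) :
    eval oddPrimitive (resolutionMap (fun t a => a + t) i c) = eval evenCocycle c := by
  refine linearMap_ext (φ := eval oddPrimitive ∘ₗ resolutionMap (fun t a => a + t) i)
    (fun l => ?_) c
  rw [resolutionMap, if_pos hi]
  rcases l with - | ⟨a, r⟩
  · simp [evenCocycle]
  · have h := evenCocycle_map_add 1 (a :: r)
    simp only [List.map_cons] at h
    simp only [LinearMap.comp_apply, LinearMap.sub_apply, mapChain_single, LinearMap.id_apply,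
      map_sub, eval_single, oddPrimitive, List.map_cons, h]
    ring

theorem eval_resolutionMap_even {i : ℕ} (hi : ¬ Odd i) (c : List (ZMod p) →₀ ZMod p) :
    eval evenPrimitive (resolutionMap (fun t a => a + t) i c) = eval oddCocycle c := by
  refine linearMap_ext (φ := eval evenPrimitive ∘ₗ resolutionMap (fun t a => a + t) i)
    (fun l => ?_) c
  rw [resolutionMap, if_neg hi]
  rcases l with - | ⟨a, - | ⟨b, r⟩⟩
  · simp [oddCocycle]
  · simp [evenPrimitive, oddCocycle]
  · have h := fun t => evenCocycle_map_add t (b :: r)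
    simp only [List.map_cons] at h
    simp only [LinearMap.comp_apply, LinearMap.sum_apply, mapChain_single, map_sum, eval_single,
      evenPrimitive, List.map_cons, h, oddCocycle, ← Finset.sum_mul, sum_descent_add]

/-- Climb the tower: each cocycle is the coboundary of a primitive, so its value on `h (i + 1)` is
that of the primitive on `bd (h (i + 1))`, a difference or norm of `h i`. Moving that operator onto
the primitive yields the previous cocycle. The start is the augmentation of `h 1`. Since `h i` has
dimension `i - 1`, odd `i` goes with `evenCocycle`. -/
theorem IsTower.eval_eq_one {n : ℕ} {h : ℕ → List (ZMod p) →₀ ZMod p}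
    (H : IsTower (fun t a => a + t) n h)
    (hs : ∀ i ≤ n, h i ∈ Finsupp.supported (ZMod p) (ZMod p) {l | l.length = i}) :
    ∀ i, 1 ≤ i → i ≤ n → eval (if Odd i then evenCocycle else oddCocycle) (h i) = 1 := by
  intro i h1
  induction i, h1 using Nat.le_induction with
  | base =>
    intro hn
    have e1 : eval evenCocycle (h 1) = (Finsupp.lapply [] ∘ₗ bd) (h 1) := by
      refine eq_of_mem_supported (fun l hl => ?_) (hs 1 hn)
      obtain ⟨a, rfl⟩ := List.length_eq_one_iff.1 hl
      simp [evenCocycle, bd_single, bdList]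
    rw [if_pos odd_one, e1, LinearMap.comp_apply, H.one, H.zero]
    simp
  | succ i h1 ih =>
    intro hn
    have ih := ih (by omega)
    by_cases hi : Odd i
    · have hi' : ¬ Odd (i + 1) := by
        rw [Nat.not_odd_iff_even]; exact hi.add_one
      rw [if_pos hi] at ih
      rw [if_neg hi']
      have e1 : eval oddCocycle (h (i + 1)) = (eval oddPrimitive ∘ₗ bd) (h (i + 1)) :=
        linearMap_ext (fun l => by simp [bd_single, eval_oddPrimitive_bdList]) _
      rw [e1, LinearMap.comp_apply, H.succ i h1 hn, eval_resolutionMap_odd hi, ih]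
    · have hi' : Odd (i + 1) := (Nat.not_odd_iff_even.1 hi).add_one
      rw [if_neg hi] at ih
      rw [if_pos hi']
      have e1 : eval evenCocycle (h (i + 1)) = (eval evenPrimitive ∘ₗ bd) (h (i + 1)) := by
        refine eq_of_mem_supported (fun l hl => ?_) (hs _ hn)
        have hl : l.length = i + 1 := hl
        rw [LinearMap.comp_apply, bd_single, eval_evenPrimitive_bdList l (by omega), eval_single]
      rw [e1, LinearMap.comp_apply, H.succ i h1 hn, eval_resolutionMap_even hi, ih]

theorem length_lt_of_isChain_gt : ∀ (n : ℕ) (L : List ℕ), L.IsChain (· > ·) →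
    (∀ x ∈ L, 1 ≤ x ∧ x < n) → L ≠ [] → L.length < n := by
  intro n L hL hx hne
  have hP : L.Pairwise (· > ·) := List.isChain_iff_pairwise.1 hL
  have hnd : L.Nodup := hP.imp fun h => Nat.ne_of_gt h
  have hsub : L.toFinset ⊆ Finset.Ico 1 n := fun x h =>
    Finset.mem_Ico.2 (hx x (List.mem_toFinset.1 h))
  have hc := Finset.card_le_card hsub
  rw [List.toFinset_card_of_nodup hnd, Nat.card_Ico] at hc
  obtain ⟨x, h⟩ := List.exists_mem_of_ne_nil L hne
  have := hx x h
  omega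

/-- A Tucker lemma for `ℤ/p`: no tower of length `n` has an equivariant labelling of its faces for
which the label changes along a flag only when the level does, with at most `n - 1` levels. -/
theorem IsTower.false_of_label {e : ZMod p → A → A} {n : ℕ} {h : ℕ → List A →₀ ZMod p}
    (hp : p ≠ 1) (H : IsTower e n h) (hn : 1 ≤ n) {F : Set (List A)}
    (hF : ∀ l ∈ F, ∀ l', l'.Sublist l → l' ∈ F)
    (hs : ∀ i ≤ n, h i ∈ Finsupp.supported (ZMod p) (ZMod p) {l | l ∈ F ∧ l.length = i})
    {b : List A → ZMod p} (hb : ∀ t, ∀ l ∈ F, l ≠ [] → b (l.map (e t)) = b l + t)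
    {level : List A → ℕ} (hlevel : ∀ l ∈ F, l ≠ [] → 1 ≤ level l ∧ level l < n)
    (hmono : ∀ l ∈ F, ∀ l', l' ≠ [] → l'.Sublist l → level l' ≤ level l ∧
      (level l' = level l → b l' = b l)) : False := by
  have H' : IsTower (fun t a => a + t) n fun i => ListChain.sd b i (h i) :=
    H.sd hF hb fun i hi => Finsupp.supported_mono (fun l hl => hl.1) (hs i hi)
  have hs' : ∀ i ≤ n, ListChain.sd b i (h i) ∈ Finsupp.supported (ZMod p) (ZMod p)
      {q | ∃ L : List (List A), q = L.map b ∧ L.length = i ∧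
        L.Pairwise (fun s s' => s'.Sublist s) ∧ ∀ s ∈ L, s ∈ F ∧ s ≠ []} := by
    intro i hi
    refine map_mem_supported (fun l hl => ?_) (hs i hi)
    refine Finsupp.supported_mono ?_ (sd_mem_supported b i l hl.2)
    rintro q ⟨L, h1, h2, h3, h4⟩
    exact ⟨L, h1, h2, h3, fun s hs => ⟨hF l hl.1 s (h4 s hs).1, (h4 s hs).2⟩⟩
  have h1 := H'.eval_eq_one (fun i hi => Finsupp.supported_mono
    (by rintro _ ⟨L, rfl, hL, -⟩; simpa using hL) (hs' i hi)) n hn le_rfl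
  have h0 : eval (if Odd n then evenCocycle else oddCocycle) (ListChain.sd b n (h n)) =
      (0 : _ →ₗ[ZMod p] ZMod p) (ListChain.sd b n (h n)) := by
    refine eq_of_mem_supported ?_ (hs' n le_rfl)
    rintro _ ⟨L, rfl, hL, hP, hLF⟩
    -- If consecutive labels differed throughout, the levels along the flag would decrease strictly,
    -- giving `n` distinct values among the `n - 1` numbers from `1` to `n - 1`.
    have hdeg : ¬ (L.map b).IsChain (· ≠ ·) := by
      intro hc
      rw [List.isChain_map, List.isChain_iff_forall_rel_of_append_cons_cons] at hc
      have hgt : (L.map level).IsChain (· > ·) := by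
        rw [List.isChain_map, List.isChain_iff_forall_rel_of_append_cons_cons]
        intro s s' l₁ l₂ hl
        have hs := hLF s (by simp [hl])
        have hs' := hLF s' (by simp [hl])
        have hsub : s'.Sublist s := by
          rw [hl] at hP
          exact List.rel_of_pairwise_cons (List.pairwise_append.1 hP).2.1 (by simp)
        obtain ⟨hle, heq⟩ := hmono s hs.1 s' hs'.2 hsub
        exact lt_of_le_of_ne hle fun h => hc hl (heq h).symm
      have := length_lt_of_isChain_gt n (L.map level) hgt
        (by
          intro x hx
          obtain ⟨s, hs, rfl⟩ := List.mem_map.1 hx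
          exact hlevel s (hLF s hs).1 (hLF s hs).2)
        (by rintro h; rw [List.map_eq_nil_iff] at h; subst h; simp at hL; omega)
      simp at this; omega
    rw [eval_single, LinearMap.zero_apply]
    split_ifs
    · exact evenCocycle_eq_zero _ hdeg
    · exact oddCocycle_eq_zero _ hdeg
  rw [h0, LinearMap.zero_apply] at h1
  have : Fact (1 < p) := ⟨by have := NeZero.ne p; omega⟩
  exact zero_ne_one h1

end Tower

/-! ### The standard tower in the join of copies of `ℤ/p`. -/

section JoinFaces

variable {p : ℕ}

/-- The shift action of `ℤ/p` on the vertices of the infinite join of copies of `ℤ/p`. -/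
def joinShift (t : ZMod p) (v : ℕ × ZMod p) : ℕ × ZMod p := (v.1, v.2 + t)

theorem joinShift_add (s t : ZMod p) (v : ℕ × ZMod p) :
    joinShift (s + t) v = joinShift s (joinShift t v) := by
  simp [joinShift, add_assoc, add_comm s t]

/-- The ordered simplices with `i` vertices in strictly decreasing join factors below `n`. -/
def joinFaces (p n i : ℕ) : Set (List (ℕ × ZMod p)) :=
  {l | l.length = i ∧ (l.map Prod.fst).Pairwise (· > ·) ∧ ∀ v ∈ l, v.1 < n}

theorem map_joinShift_mem_joinFaces {n i : ℕ} {l : List (ℕ × ZMod p)} (hl : l ∈ joinFaces p n i)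
    (t : ZMod p) : l.map (joinShift t) ∈ joinFaces p n i := by
  refine ⟨by simp [hl.1], ?_, ?_⟩
  · have : Prod.fst ∘ joinShift t = (Prod.fst : ℕ × ZMod p → ℕ) := rfl
    rw [List.map_map, this]
    exact hl.2.1
  · intro v hv
    obtain ⟨w, hw, rfl⟩ := List.mem_map.1 hv
    exact hl.2.2 w hw

/-- The faces of the join of `n` copies of `ℤ/p`, together with the empty set. -/
def IsSignVector (n : ℕ) (X : Finset (ℕ × ZMod p)) : Prop :=
  (∀ v ∈ X, v.1 < n) ∧ ∀ v ∈ X, ∀ w ∈ X, v.1 = w.1 → v = w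

theorem isSignVector_toFinset {n i : ℕ} {l : List (ℕ × ZMod p)} (hl : l ∈ joinFaces p n i) :
    IsSignVector n l.toFinset := by
  refine ⟨fun v hv => hl.2.2 v (List.mem_toFinset.1 hv), fun v hv w hw h => ?_⟩
  have hnd : (l.map Prod.fst).Nodup := hl.2.1.imp fun h => Nat.ne_of_gt h
  exact List.inj_on_of_nodup_map hnd (List.mem_toFinset.1 hv) (List.mem_toFinset.1 hw) h

end JoinFaces

section Base

variable {p : ℕ} [NeZero p] {A : Type*}

theorem bd_resolutionMap (e : ZMod p → A → A) (i : ℕ) (c : List A →₀ ZMod p) :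
    bd (resolutionMap e i c) = resolutionMap e i (bd c) := by
  unfold resolutionMap
  split_ifs
  · simp [mapChain_bd]
  · simp [LinearMap.sum_apply, mapChain_bd]

theorem resolutionMap_resolutionMap {e : ZMod p → A → A}
    (he : ∀ s t a, e (s + t) a = e s (e t a)) (i : ℕ) (c : List A →₀ ZMod p) :
    resolutionMap e (i + 1) (resolutionMap e i c) = 0 := by
  have h : ∀ s t, mapChain (e s) (mapChain (e t) c) = mapChain (e (s + t)) c := fun s t => by
    rw [mapChain_mapChain]
    congr 2
    funext a
    exact (he s t a).symm
  by_cases hi : Odd i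
  · have hi' : ¬ Odd (i + 1) := by rw [Nat.not_odd_iff_even]; exact hi.add_one
    simp only [resolutionMap, if_pos hi, if_neg hi', LinearMap.sum_apply, LinearMap.sub_apply,
      LinearMap.id_apply, map_sub, h]
    rw [sub_eq_zero]
    exact Equiv.sum_comp (Equiv.addRight (1 : ZMod p)) fun t => mapChain (e t) c
  · have hi' : Odd (i + 1) := (Nat.not_odd_iff_even.1 hi).add_one
    simp only [resolutionMap, if_neg hi, if_pos hi', LinearMap.sum_apply, LinearMap.sub_apply,
      LinearMap.id_apply, map_sum, h]
    rw [Finset.sum_sub_distrib, sub_eq_zero]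
    exact Equiv.sum_comp (Equiv.addLeft (1 : ZMod p)) fun t => mapChain (e t) c

/-- The tower in the infinite join of copies of `ℤ/p` built from iterated cones. -/
noncomputable def joinTower : ℕ → List (ℕ × ZMod p) →₀ ZMod p
  | 0 => Finsupp.single [] 1
  | 1 => Finsupp.single [(0, 0)] 1
  | i + 2 => cone (i + 1, 0) (resolutionMap joinShift (i + 1) (joinTower (i + 1)))

/-- The correction term in the boundary of the cone vanishes: consecutive operators of the
resolution compose to zero, and at the bottom the difference operator kills the empty simplex. -/
theorem bd_joinTower : ∀ i, bd (joinTower (p := p) (i + 2)) =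
    resolutionMap joinShift (i + 1) (joinTower (i + 1))
  | 0 => by
    rw [joinTower.eq_3, bd_cone, bd_resolutionMap, joinTower.eq_2]
    simp [bd_single, bdList, resolutionMap]
  | i + 1 => by
    rw [joinTower, bd_cone, bd_resolutionMap, bd_joinTower i,
      resolutionMap_resolutionMap joinShift_add, map_zero, sub_zero]

theorem isTower_joinTower (n : ℕ) : IsTower (p := p) joinShift n joinTower where
  zero := rfl
  one := by simp [joinTower, bd_single, bdList]
  succ i h1 _ := by
    obtain ⟨j, rfl⟩ := Nat.exists_eq_add_of_le' h1
    exact bd_joinTower j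

theorem resolutionMap_mem_supported {e : ZMod p → A → A} {F : Set (List A)}
    (hF : ∀ l ∈ F, ∀ t, l.map (e t) ∈ F) (i : ℕ) {c : List A →₀ ZMod p}
    (hc : c ∈ Finsupp.supported (ZMod p) (ZMod p) F) :
    resolutionMap e i c ∈ Finsupp.supported (ZMod p) (ZMod p) F := by
  have h : ∀ t, mapChain (e t) c ∈ Finsupp.supported (ZMod p) (ZMod p) F := fun t =>
    map_mem_supported (fun l hl => by
      rw [mapChain_single]; exact Finsupp.single_mem_supported _ _ (hF l hl t)) hc
  unfold resolutionMap
  split_ifs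
  · exact Submodule.sub_mem _ (h 1) hc
  · rw [LinearMap.sum_apply]
    exact Submodule.sum_mem _ fun t _ => h t

theorem joinTower_mem_supported : ∀ i, joinTower (p := p) i ∈
    Finsupp.supported (ZMod p) (ZMod p) (joinFaces p i i)
  | 0 => Finsupp.single_mem_supported _ _ (by simp [joinFaces])
  | 1 => Finsupp.single_mem_supported _ _ (by simp [joinFaces])
  | i + 2 => by
    rw [joinTower]
    refine map_mem_supported (fun l hl => ?_) (resolutionMap_mem_supported
      (fun l hl t => map_joinShift_mem_joinFaces hl t) _ (joinTower_mem_supported (i + 1)))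
    rw [cone_single]
    refine Finsupp.single_mem_supported _ _ ⟨by simp [hl.1], ?_, ?_⟩
    · rw [List.map_cons, List.pairwise_cons]
      refine ⟨fun j hj => ?_, hl.2.1⟩
      obtain ⟨v, hv, rfl⟩ := List.mem_map.1 hj
      exact hl.2.2 v hv
    · intro v hv
      rcases List.mem_cons.1 hv with rfl | hv
      · exact Nat.lt_succ_self _
      · exact (hl.2.2 v hv).trans (Nat.lt_succ_self _)

theorem joinTower_mem_supported_of_le {i n : ℕ} (hi : i ≤ n) : joinTower (p := p) i ∈
    Finsupp.supported (ZMod p) (ZMod p) (joinFaces p n i) :=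
  Finsupp.supported_mono (s := joinFaces p i i) (t := joinFaces p n i)
    (fun _ hl => ⟨hl.1, hl.2.1, fun v hv => (hl.2.2 v hv).trans_le hi⟩) (joinTower_mem_supported i)

end Base

/-! ### Equivariant signs and the Tucker lemma for sign vectors. -/

section Sign

variable {p : ℕ} [Fact p.Prime]

/-- Every action of `ℤ/p` has an equivariant map to `ℤ/p` away from its fixed points. -/
theorem exists_equivariant_sign {Y : Type*} (e : ZMod p → Y → Y) (h0 : ∀ y, e 0 y = y)
    (hadd : ∀ s t y, e (s + t) y = e s (e t y)) :
    ∃ s : Y → ZMod p, ∀ y, e 1 y ≠ y → ∀ t, s (e t y) = s y + t := by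
  classical
  let r : Setoid Y :=
    { r := fun y y' => ∃ t, e t y = y'
      iseqv :=
        { refl := fun y => ⟨0, h0 y⟩
          symm := by
            rintro y _ ⟨t, rfl⟩
            exact ⟨-t, by rw [← hadd, neg_add_cancel, h0]⟩
          trans := by
            rintro y _ _ ⟨t, rfl⟩ ⟨s, rfl⟩
            exact ⟨s + t, hadd s t y⟩ } }
  have hex : ∀ y, ∃ t, e t (Quotient.mk r y).out = y := fun y => Quotient.mk_out (s := r) y
  choose s hs using hex
  refine ⟨s, fun y hy t => ?_⟩
  have hq : Quotient.mk r (e t y) = Quotient.mk r y :=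
    (Quotient.sound (s := r) ⟨t, rfl⟩ : Quotient.mk r y = Quotient.mk r (e t y)).symm
  have h1 := hs (e t y)
  rw [hq] at h1
  have h2 := hs y
  set z := (Quotient.mk r y).out
  have h3 : e (-(t + s y) + s (e t y)) z = z := by
    rw [hadd, h1]
    conv_lhs => rw [← h2]
    rw [← hadd, ← hadd, h2]
    convert h0 z using 2
    ring
  set a := -(t + s y) + s (e t y) with ha
  by_cases ha0 : a = 0
  · rw [ha0] at ha
    linear_combination -ha
  · exfalso
    apply hy
    -- Since `p` is prime, a nonzero `a` in the stabilizer of `z` generates the group, so `1` would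
    -- fix `z` and hence `y`.
    have hiter : ∀ k : ℕ, e ((k : ZMod p) * a) z = z := by
      intro k
      induction k with
      | zero => simp [h0]
      | succ k ih => rw [Nat.cast_succ, add_one_mul, hadd, h3, ih]
    have h4 := hiter (a⁻¹).val
    rw [ZMod.natCast_zmod_val, inv_mul_cancel₀ ha0] at h4
    rw [← h2, ← hadd, add_comm, hadd, h4]

end Sign

section Tucker

variable {p : ℕ} [Fact p.Prime]

/-- The `ℤ/p`-Tucker lemma. -/
theorem tucker {n : ℕ} (hn : 1 ≤ n) (label : Finset (ℕ × ZMod p) → ZMod p)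
    (level : Finset (ℕ × ZMod p) → ℕ)
    (hlabel : ∀ t X, IsSignVector n X → X.Nonempty → label (X.image (joinShift t)) = label X + t)
    (hlevel : ∀ X, IsSignVector n X → X.Nonempty → 1 ≤ level X ∧ level X < n)
    (hmono : ∀ X, IsSignVector n X → ∀ X', X'.Nonempty → X' ⊆ X → level X' ≤ level X ∧
      (level X' = level X → label X' = label X)) : False := by
  have hne : ∀ l : List (ℕ × ZMod p), l ≠ [] → l.toFinset.Nonempty := fun l hl =>
    List.toFinset_nonempty_iff _ |>.2 hl
  refine (isTower_joinTower (p := p) n).false_of_label (Fact.out : p.Prime).one_lt.ne' hn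
    (F := {l | ∃ i, l ∈ joinFaces p n i}) ?_
    (fun i hi => Finsupp.supported_mono ?_ (joinTower_mem_supported_of_le hi))
    (b := fun l => label l.toFinset) ?_ (level := fun l => level l.toFinset) ?_ ?_
  · rintro l ⟨i, hl⟩ l' hl'
    exact ⟨_, rfl, hl.2.1.sublist (hl'.map _), fun v hv => hl.2.2 v (hl'.subset hv)⟩
  · exact fun l hl => ⟨⟨i, hl⟩, hl.1⟩
  · rintro t l ⟨i, hl⟩ h
    have : (l.map (joinShift t)).toFinset = l.toFinset.image (joinShift t) := by
      ext; simp
    simp only [this]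
    exact hlabel t _ (isSignVector_toFinset hl) (hne l h)
  · rintro l ⟨i, hl⟩ h
    exact hlevel _ (isSignVector_toFinset hl) (hne l h)
  · rintro l ⟨i, hl⟩ l' h hl'
    refine hmono _ (isSignVector_toFinset hl) _ (hne l' h) fun v hv => ?_
    exact List.mem_toFinset.2 (hl'.subset (List.mem_toFinset.1 hv))

end Tucker

/-! ### Positions in a matrix with no complete row. -/

section Rows

variable {p : ℕ} [Fact p.Prime] {ι : Type*} [DecidableEq ι]

/-- The shift of the columns of a set of positions in a matrix. -/
def colShift (t : ZMod p) (S : Finset (ι × ZMod p)) : Finset (ι × ZMod p) :=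
  S.image fun v => (v.1, v.2 + t)

theorem mem_colShift {t : ZMod p} {S : Finset (ι × ZMod p)} {j : ι} {i : ZMod p} :
    (j, i) ∈ colShift t S ↔ (j, i - t) ∈ S := by
  simp only [colShift, Finset.mem_image, Prod.mk.injEq, Prod.exists]
  constructor
  · rintro ⟨a, b, h, rfl, rfl⟩
    simpa using h
  · exact fun h => ⟨j, i - t, h, rfl, by ring⟩

theorem colShift_zero (S : Finset (ι × ZMod p)) : colShift 0 S = S := by
  ext ⟨j, i⟩; simp [mem_colShift]

theorem colShift_add (s t : ZMod p) (S : Finset (ι × ZMod p)) :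
    colShift (s + t) S = colShift s (colShift t S) := by
  ext ⟨j, i⟩; simp [mem_colShift, sub_sub]

theorem colShift_one_ne {S : Finset (ι × ZMod p)} (hS : S.Nonempty)
    (hrow : ∀ j, ∃ i, (j, i) ∉ S) : colShift 1 S ≠ S := by
  intro h
  obtain ⟨⟨j, i⟩, hji⟩ := hS
  obtain ⟨i', hi'⟩ := hrow j
  have hk : ∀ k : ℕ, (j, i + k) ∈ S := by
    intro k
    induction k with
    | zero => simpa using hji
    | succ k ih =>
      rw [← h, mem_colShift]
      convert ih using 2
      push_cast; ring
  apply hi'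
  have := hk (i' - i).val
  rwa [ZMod.natCast_zmod_val, add_sub_cancel] at this

theorem card_le_of_row [Fintype ι] {S : Finset (ι × ZMod p)} (hrow : ∀ j, ∃ i, (j, i) ∉ S) :
    S.card ≤ Fintype.card ι * (p - 1) := by
  rw [Finset.card_eq_sum_card_fiberwise (f := Prod.fst) (t := Finset.univ) (fun _ _ => by simp)]
  refine (Finset.sum_le_card_nsmul _ _ (p - 1) fun j _ => ?_).trans (by simp)
  obtain ⟨i, hi⟩ := hrow j
  have hsub : (S.filter fun v => v.1 = j) ⊆ (Finset.univ.erase i).image fun i' => (j, i') := by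
    rintro ⟨j', i'⟩ hv
    obtain ⟨hv', hj⟩ := Finset.mem_filter.1 hv
    obtain rfl : j' = j := hj
    refine Finset.mem_image.2 ⟨i', Finset.mem_erase.2 ⟨?_, Finset.mem_univ _⟩, rfl⟩
    rintro rfl
    exact hi hv'
  refine (Finset.card_le_card hsub).trans (Finset.card_image_le.trans ?_)
  rw [Finset.card_erase_of_mem (Finset.mem_univ _), Finset.card_univ, ZMod.card]

end Rows

/-! ### Levels and signs of families of disjoint sets. -/

section Rotation

variable {p : ℕ} {γ τ : Type*}

/-- Rotation of a family indexed by `ℤ/p`. -/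
def rot (t : ZMod p) (f : ZMod p → γ) : ZMod p → γ := fun g => f (g - t)

@[simp] theorem rot_zero (f : ZMod p → γ) : rot 0 f = f := by
  funext g; simp [rot]

theorem rot_add (s t : ZMod p) (f : ZMod p → γ) : rot (s + t) f = rot s (rot t f) := by
  funext g; simp [rot, sub_sub]

theorem eq_apply_zero_of_rot_one [NeZero p] {f : ZMod p → γ} (h : rot 1 f = f) (g : ZMod p) :
    f g = f 0 := by
  have hk : ∀ k : ℕ, f k = f 0 := by
    intro k
    induction k with
    | zero => simp
    | succ k ih =>
      rw [← ih]
      have := congrFun h ((k + 1 : ℕ) : ZMod p)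
      simpa [rot] using this.symm
  simpa using hk g.val

/-- The sizes of the members of a family, cut off at `k`. -/
def truncCard (k : ℕ) (U : ZMod p → Finset τ) (g : ZMod p) : ℕ := min (U g).card k

open Classical in
/-- The level of a family of disjoint sets: its total size if all members have at least `k`
elements, and the sum of the truncated sizes otherwise. -/
noncomputable def weight [NeZero p] (k : ℕ) (U : ZMod p → Finset τ) : ℕ :=
  if ∀ g, k ≤ (U g).card then ∑ g, (U g).card else ∑ g, truncCard k U g

open Classical in
/-- An invariant of a family of disjoint sets that determines an equivariant sign. -/
noncomputable def signData (k : ℕ) (U : ZMod p → Finset τ) :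
    (ZMod p → ℕ) × (ZMod p → Finset τ) :=
  (truncCard k U, if ∀ g, truncCard k U g = truncCard k U 0 then U else fun _ => ∅)

variable {k : ℕ} {U U' : ZMod p → Finset τ}

theorem truncCard_mono (h : ∀ g, U g ⊆ U' g) (g : ZMod p) : truncCard k U g ≤ truncCard k U' g :=
  min_le_min_right _ (Finset.card_le_card (h g))

theorem truncCard_rot (t : ZMod p) : truncCard k (rot t U) = rot t (truncCard k U) := rfl

theorem sum_truncCard_lt [NeZero p] (h : ¬ ∀ g, k ≤ (U g).card) :
    ∑ g, truncCard k U g < p * k := by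
  obtain ⟨g, hg⟩ := not_forall.1 h
  calc ∑ g, truncCard k U g < ∑ _g : ZMod p, k :=
        Finset.sum_lt_sum (fun _ _ => min_le_right _ _)
          ⟨g, Finset.mem_univ _, (min_le_left _ _).trans_lt (not_le.1 hg)⟩
    _ = p * k := by simp [ZMod.card]

theorem mul_le_sum_card [NeZero p] (h : ∀ g, k ≤ (U g).card) : p * k ≤ ∑ g, (U g).card := by
  calc p * k = ∑ _g : ZMod p, k := by simp [ZMod.card]
    _ ≤ _ := Finset.sum_le_sum fun g _ => h g

/-- The value `p * k` separates the two regimes of `weight`, so equality keeps both families in the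
same one. Equal total sizes force equal families. Below the threshold, truncated sizes agree; if
they are constant, they are smaller than `k`, so nothing was truncated and the families agree again.
-/
theorem weight_mono [NeZero p] (h : ∀ g, U g ⊆ U' g) :
    weight k U ≤ weight k U' ∧ (weight k U = weight k U' → signData k U = signData k U') := by
  have hle : ∀ g, (U g).card ≤ (U' g).card := fun g => Finset.card_le_card (h g)
  unfold weight
  by_cases h1 : ∀ g, k ≤ (U g).card
  · have h2 : ∀ g, k ≤ (U' g).card := fun g => (h1 g).trans (hle g)
    rw [if_pos h1, if_pos h2]
    refine ⟨Finset.sum_le_sum fun g _ => hle g, fun heq => ?_⟩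
    have := (Finset.sum_eq_sum_iff_of_le fun g _ => hle g).1 heq
    have : U = U' := funext fun g => Finset.eq_of_subset_of_card_le (h g)
      (this g (Finset.mem_univ g)).ge
    rw [this]
  · rw [if_neg h1]
    by_cases h2 : ∀ g, k ≤ (U' g).card
    · rw [if_pos h2]
      have := (sum_truncCard_lt h1).trans_le (mul_le_sum_card h2)
      exact ⟨this.le, fun h => absurd h this.ne⟩
    · rw [if_neg h2]
      refine ⟨Finset.sum_le_sum fun g _ => truncCard_mono h g, fun heq => ?_⟩
      have h3 := (Finset.sum_eq_sum_iff_of_le fun g _ => truncCard_mono h g).1 heq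
      have h4 : truncCard k U = truncCard k U' := funext fun g => h3 g (Finset.mem_univ g)
      unfold signData
      rw [← h4]
      by_cases h5 : ∀ g, truncCard k U g = truncCard k U 0
      · rw [if_pos h5, if_pos h5]
        obtain ⟨g₀, hg₀⟩ := not_forall.1 h2
        have : U = U' := funext fun g => Finset.eq_of_subset_of_card_le (h g) (by
          have e1 := (h5 g).trans (h5 g₀).symm
          have e2 := congrFun h4 g
          have e3 := congrFun h4 g₀
          simp only [truncCard] at e1 e2 e3
          omega)
        rw [this]
      · rw [if_neg h5, if_neg h5]

theorem weight_pos [NeZero p] (hk : 1 ≤ k) {g : ZMod p} (hg : (U g).Nonempty) :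
    1 ≤ weight k U := by
  have hc := hg.card_pos
  unfold weight
  split_ifs
  · exact hc.trans_le (Finset.single_le_sum (f := fun g => (U g).card) (fun _ _ => Nat.zero_le _)
      (Finset.mem_univ g))
  · exact (le_min hc hk).trans (Finset.single_le_sum (f := truncCard k U)
      (fun _ _ => Nat.zero_le _) (Finset.mem_univ g))

theorem weight_le_sum_card [NeZero p] : weight k U ≤ ∑ g, (U g).card := by
  unfold weight
  split_ifs
  · exact le_rfl
  · exact Finset.sum_le_sum fun g _ => min_le_left _ _

theorem weight_lt [NeZero p] (h : ¬ ∀ g, k ≤ (U g).card) : weight k U < p * k := by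
  rw [weight, if_neg h]
  exact sum_truncCard_lt h

theorem signData_rot (t : ZMod p) :
    signData k (rot t U) = (rot t (signData k U).1, rot t (signData k U).2) := by
  have hiff : (∀ g, truncCard k (rot t U) g = truncCard k (rot t U) 0) ↔
      ∀ g, truncCard k U g = truncCard k U 0 := by
    simp only [truncCard_rot, rot]
    constructor
    · intro h g
      have h1 := h (g + t)
      have h2 := h t
      rw [add_sub_cancel_right] at h1
      rw [sub_self] at h2
      rw [h1, h2]
    · intro h g
      rw [h (g - t), h (0 - t)]
  refine Prod.ext rfl ?_
  by_cases h : ∀ g, truncCard k U g = truncCard k U 0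
  · simp only [signData, if_pos h, if_pos (hiff.2 h)]
  · simp only [signData, if_neg h, if_neg fun h' => h (hiff.1 h')]
    rfl

/-- Invariant sizes are constant, so the second component is the family itself; an invariant family
has equal members, and equal disjoint sets are empty. Thus the sign data of a nonempty family is
never fixed. -/
theorem eq_empty_of_rot_signData [Fact p.Prime] (hd : ∀ g g', g ≠ g' → Disjoint (U g) (U g'))
    (h1 : rot 1 (signData k U).1 = (signData k U).1)
    (h2 : rot 1 (signData k U).2 = (signData k U).2) (g : ZMod p) : U g = ∅ := by
  have hc : ∀ g, truncCard k U g = truncCard k U 0 := eq_apply_zero_of_rot_one h1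
  have e : (signData k U).2 = U := by simp only [signData, if_pos hc]
  rw [e] at h2
  have h3 := eq_apply_zero_of_rot_one h2
  have h4 := hd 0 1 zero_ne_one
  rw [h3 1, disjoint_self] at h4
  rw [h3 g, h4]
  rfl

end Rotation

/-! ### The Tucker labelling for products of Kneser hypergraphs. -/

section Kneser

variable {p : ℕ} {σ τ : Type*} {m : ℕ}

open Classical in
/-- The pairs of a color `j` and an index `g` such that some pair of a `k₁`-subset of `U g` and a
`k₂`-subset of `V g` has color `j`. -/
noncomputable def colorSet [NeZero p] (k₁ k₂ : ℕ) (c : Finset σ × Finset τ → Fin m)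
    (W : (ZMod p → Finset σ) × (ZMod p → Finset τ)) : Finset (Fin m × ZMod p) :=
  Finset.univ.filter fun v => ∃ A ⊆ W.1 v.2, ∃ B ⊆ W.2 v.2, A.card = k₁ ∧ B.card = k₂ ∧
    c (A, B) = v.1

variable {k₁ k₂ : ℕ} {c : Finset σ × Finset τ → Fin m}
  {W W' : (ZMod p → Finset σ) × (ZMod p → Finset τ)}

theorem mem_colorSet [NeZero p] {j : Fin m} {g : ZMod p} : (j, g) ∈ colorSet k₁ k₂ c W ↔
    ∃ A ⊆ W.1 g, ∃ B ⊆ W.2 g, A.card = k₁ ∧ B.card = k₂ ∧ c (A, B) = j := by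
  simp [colorSet]

theorem colorSet_mono [NeZero p] (h1 : ∀ g, W.1 g ⊆ W'.1 g) (h2 : ∀ g, W.2 g ⊆ W'.2 g) :
    colorSet k₁ k₂ c W ⊆ colorSet k₁ k₂ c W' := by
  rintro ⟨j, g⟩ h
  obtain ⟨A, hA, B, hB, h⟩ := mem_colorSet.1 h
  exact mem_colorSet.2 ⟨A, hA.trans (h1 g), B, hB.trans (h2 g), h⟩

theorem colorSet_rot [Fact p.Prime] (t : ZMod p) :
    colorSet k₁ k₂ c (rot t W.1, rot t W.2) = colShift t (colorSet k₁ k₂ c W) := by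
  ext ⟨j, g⟩
  rw [mem_colShift, mem_colorSet, mem_colorSet]
  rfl

theorem exists_mem_colorSet [NeZero p] (h1 : ∀ g, k₁ ≤ (W.1 g).card)
    (h2 : ∀ g, k₂ ≤ (W.2 g).card) (g : ZMod p) : ∃ j, (j, g) ∈ colorSet k₁ k₂ c W := by
  obtain ⟨A, hA, hA'⟩ := Finset.exists_subset_card_eq (h1 g)
  obtain ⟨B, hB, hB'⟩ := Finset.exists_subset_card_eq (h2 g)
  exact ⟨_, mem_colorSet.2 ⟨A, hA, B, hB, hA', hB', rfl⟩⟩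

theorem le_card_colorSet [NeZero p] (h1 : ∀ g, k₁ ≤ (W.1 g).card)
    (h2 : ∀ g, k₂ ≤ (W.2 g).card) : p ≤ (colorSet k₁ k₂ c W).card := by
  choose j hj using exists_mem_colorSet (c := c) h1 h2
  calc p = (Finset.univ.image fun g => (j g, g)).card := by
        rw [Finset.card_image_of_injective _ fun a b h => (Prod.mk.inj h).2, Finset.card_univ,
          ZMod.card]
    _ ≤ _ := Finset.card_le_card fun v hv => by
        obtain ⟨g, -, rfl⟩ := Finset.mem_image.1 hv
        exact hj g

/-- The `ℤ/p`-Tucker lemma applied to colorings of products of Kneser hypergraphs. -/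
theorem le_mul_of_coloring [Fact p.Prime] {n₁ n₂ k₁ k₂ d : ℕ} (hk₁ : 1 ≤ k₁) (hk₂ : 1 ≤ k₂)
    (hd : 1 ≤ d) (hn₁ : p * k₁ + d ≤ n₁ + 1) (hn₂ : p * k₂ + d ≤ n₂ + 1)
    (c : Finset (Fin n₁) × Finset (Fin n₂) → Fin m)
    (hc : ∀ (A : ZMod p → Finset (Fin n₁)) (B : ZMod p → Finset (Fin n₂)),
      (∀ g, (A g).card = k₁) → (∀ g, (B g).card = k₂) →
      (∀ g g', g ≠ g' → Disjoint (A g) (A g')) → (∀ g g', g ≠ g' → Disjoint (B g) (B g')) →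
      ∀ j, ∃ g, c (A g, B g) ≠ j) :
    d ≤ (m - 1) * (p - 1) := by
  classical
  have hp : 2 ≤ p := (Fact.out : p.Prime).two_le
  have hpk₁ : 2 ≤ p * k₁ := hp.trans (Nat.le_mul_of_pos_right _ hk₁)
  have hpk₂ : 2 ≤ p * k₂ := hp.trans (Nat.le_mul_of_pos_right _ hk₂)
  by_contra hlt
  rw [not_le] at hlt
  have hm : 1 ≤ m := (c (∅, ∅)).pos
  have hmp : m * (p - 1) = (m - 1) * (p - 1) + (p - 1) := by
    obtain ⟨m', rfl⟩ := Nat.exists_eq_add_of_le' hm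
    simp [add_mul]
  -- Only the first `N₁` and `N₂` points are used, giving both ground sets the same surplus `d - 1`
  -- over `p * k₁` and `p * k₂`.
  obtain ⟨N₁, hN₁⟩ : ∃ N₁, N₁ + 1 = p * k₁ + d := ⟨p * k₁ + d - 1, by omega⟩
  obtain ⟨N₂, hN₂⟩ : ∃ N₂, N₂ + 1 = p * k₂ + d := ⟨p * k₂ + d - 1, by omega⟩
  let W : Finset (ℕ × ZMod p) → (ZMod p → Finset (Fin n₁)) × (ZMod p → Finset (Fin n₂)) := fun X =>
    (fun g => Finset.univ.filter fun a => a.val < N₁ ∧ (a.val, g) ∈ X,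
      fun g => Finset.univ.filter fun b => (N₁ + b.val, g) ∈ X)
  have hWmono : ∀ X X' : Finset (ℕ × ZMod p), X' ⊆ X →
      (∀ g, (W X').1 g ⊆ (W X).1 g) ∧ ∀ g, (W X').2 g ⊆ (W X).2 g := by
    intro X X' h
    constructor
    · intro g a ha
      simp only [W, Finset.mem_filter, Finset.mem_univ, true_and] at ha ⊢
      exact ⟨ha.1, h ha.2⟩
    · intro g b hb
      simp only [W, Finset.mem_filter, Finset.mem_univ, true_and] at hb ⊢
      exact h hb
  have hshift : ∀ (t : ZMod p) (X : Finset (ℕ × ZMod p)) (a : ℕ) (g : ZMod p),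
      (a, g) ∈ X.image (joinShift t) ↔ (a, g - t) ∈ X := fun t X a g => mem_colShift
  have hWrot : ∀ (t : ZMod p) (X : Finset (ℕ × ZMod p)),
      W (X.image (joinShift t)) = (rot t (W X).1, rot t (W X).2) := by
    intro t X
    refine Prod.ext (funext fun g => ?_) (funext fun g => ?_) <;>
      simp only [W, rot, hshift]
  have hdisj : ∀ X, IsSignVector (N₁ + N₂) X →
      (∀ g g', g ≠ g' → Disjoint ((W X).1 g) ((W X).1 g')) ∧
      ∀ g g', g ≠ g' → Disjoint ((W X).2 g) ((W X).2 g') := by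
    intro X hX
    constructor
    · intro g g' hg
      rw [Finset.disjoint_left]
      intro a ha ha'
      simp only [W, Finset.mem_filter, Finset.mem_univ, true_and] at ha ha'
      exact hg (Prod.mk.inj (hX.2 _ ha.2 _ ha'.2 rfl)).2
    · intro g g' hg
      rw [Finset.disjoint_left]
      intro a ha ha'
      simp only [W, Finset.mem_filter, Finset.mem_univ, true_and] at ha ha'
      exact hg (Prod.mk.inj (hX.2 _ ha _ ha' rfl)).2
  have hcard : ∀ X, IsSignVector (N₁ + N₂) X →
      ∑ g, ((W X).1 g).card ≤ N₁ ∧ ∑ g, ((W X).2 g).card ≤ N₂ := by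
    intro X hX
    have key : ∀ {N n : ℕ} (V : ZMod p → Finset (Fin n)),
        (∀ g g', g ≠ g' → Disjoint (V g) (V g')) → (∀ g, ∀ a ∈ V g, a.val < N) →
        ∑ g, (V g).card ≤ N := by
      intro N n V hV hN
      rw [← Finset.card_biUnion fun g _ g' _ h => hV g g' h,
        ← Finset.card_image_of_injective _ Fin.val_injective]
      refine (Finset.card_le_card (t := Finset.range N) ?_).trans (Finset.card_range N).le
      intro x hx
      obtain ⟨a, ha, rfl⟩ := Finset.mem_image.1 hx
      obtain ⟨g, -, ha⟩ := Finset.mem_biUnion.1 ha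
      exact Finset.mem_range.2 (hN g a ha)
    refine ⟨key _ (hdisj X hX).1 fun g a ha => ?_, key _ (hdisj X hX).2 fun g b hb => ?_⟩
    · simp only [W, Finset.mem_filter, Finset.mem_univ, true_and] at ha
      exact ha.1
    · simp only [W, Finset.mem_filter, Finset.mem_univ, true_and] at hb
      have := hX.1 _ hb
      simp only at this
      omega
  have hne : ∀ X, IsSignVector (N₁ + N₂) X → X.Nonempty →
      ∃ g, ((W X).1 g).Nonempty ∨ ((W X).2 g).Nonempty := by
    rintro X hX ⟨⟨a, g⟩, h⟩
    have ha : a < N₁ + N₂ := hX.1 _ h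
    refine ⟨g, ?_⟩
    by_cases h1 : a < N₁
    · exact Or.inl ⟨⟨a, by omega⟩, by simpa [W] using ⟨h1, h⟩⟩
    · refine Or.inr ⟨⟨a - N₁, by omega⟩, ?_⟩
      simp only [W, Finset.mem_filter, Finset.mem_univ, true_and]
      rwa [Nat.add_sub_cancel' (not_lt.1 h1)]
  -- A complete row `j` would produce disjoint sets in each factor whose pairs all have color `j`.
  have hrow : ∀ X, IsSignVector (N₁ + N₂) X → ∀ j, ∃ g, (j, g) ∉ colorSet k₁ k₂ c (W X) := by
    intro X hX j
    by_contra hall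
    push Not at hall
    choose A hA B hB hA' hB' hAB using fun g => mem_colorSet.1 (hall g)
    obtain ⟨g, hg⟩ := hc A B hA' hB'
      (fun g g' h => ((hdisj X hX).1 g g' h).mono (hA g) (hA g'))
      (fun g g' h => ((hdisj X hX).2 g g' h).mono (hB g) (hB g')) j
    exact hg (hAB g)
  let full : Finset (ℕ × ZMod p) → Prop := fun X =>
    (∀ g, k₁ ≤ ((W X).1 g).card) ∧ ∀ g, k₂ ≤ ((W X).2 g).card
  have hfullmono : ∀ X X' : Finset (ℕ × ZMod p), X' ⊆ X → full X' → full X := fun X X' h hf =>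
    ⟨fun g => (hf.1 g).trans (Finset.card_le_card ((hWmono X X' h).1 g)),
      fun g => (hf.2 g).trans (Finset.card_le_card ((hWmono X X' h).2 g))⟩
  obtain ⟨s₁, hs₁⟩ := exists_equivariant_sign (p := p) (Y := Finset (Fin m × ZMod p)) colShift
    colShift_zero colShift_add
  obtain ⟨s₂, hs₂⟩ := exists_equivariant_sign (p := p)
    (Y := ((ZMod p → ℕ) × (ZMod p → Finset (Fin n₁))) × ((ZMod p → ℕ) × (ZMod p → Finset (Fin n₂))))
    (fun t y => ((rot t y.1.1, rot t y.1.2), (rot t y.2.1, rot t y.2.2)))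
    (fun y => by simp) (fun s t y => by simp [rot_add])
  -- Non-full vectors lie below `p * k₁ + p * k₂ + d - 1` by `hlow`, and full ones start there,
  -- since their color set has at least `p` elements. It has at most `m * (p - 1)`, so under `hlt`
  -- the level stays below `N₁ + N₂ = p * k₁ + p * k₂ + 2 * d - 2`.
  let level : Finset (ℕ × ZMod p) → ℕ := fun X =>
    if full X then p * k₁ + p * k₂ + d - 1 + ((colorSet k₁ k₂ c (W X)).card - p)
    else weight k₁ (W X).1 + weight k₂ (W X).2
  let label : Finset (ℕ × ZMod p) → ZMod p := fun X =>
    if full X then s₁ (colorSet k₁ k₂ c (W X))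
    else s₂ (signData k₁ (W X).1, signData k₂ (W X).2)
  have hlow : ∀ X, IsSignVector (N₁ + N₂) X → ¬ full X →
      weight k₁ (W X).1 + weight k₂ (W X).2 < p * k₁ + p * k₂ + d - 1 := by
    intro X hX hf
    have h1 := (weight_le_sum_card (k := k₁) (U := (W X).1)).trans (hcard X hX).1
    -- One weight is below its threshold `p * kᵢ`; the other exceeds its own by at most `d - 1`.
    have h2 := (weight_le_sum_card (k := k₂) (U := (W X).2)).trans (hcard X hX).2
    rcases not_and_or.1 hf with h | h
    · have := weight_lt h
      omega
    · have := weight_lt h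
      omega
  refine tucker (p := p) (n := N₁ + N₂) (by omega) label level ?_ ?_ ?_
  · intro t X hX hX0
    have hfull : full (X.image (joinShift t)) ↔ full X := by
      have hiff : ∀ {n : ℕ} (k : ℕ) (V : ZMod p → Finset (Fin n)),
          (∀ g, k ≤ (rot t V g).card) ↔ ∀ g, k ≤ (V g).card := fun k V =>
        ⟨fun h g => by simpa [rot] using h (g + t), fun h g => h _⟩
      simp only [full, hWrot, hiff]
    simp only [label, hfull]
    split_ifs with hf
    · rw [hWrot, colorSet_rot]
      obtain ⟨j, hj⟩ := exists_mem_colorSet (c := c) hf.1 hf.2 0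
      exact hs₁ _ (colShift_one_ne ⟨_, hj⟩ (hrow X hX)) t
    · rw [hWrot, signData_rot, signData_rot]
      refine hs₂ (signData k₁ (W X).1, signData k₂ (W X).2) (fun heq => ?_) t
      simp only [Prod.mk.injEq] at heq
      obtain ⟨g, hg⟩ := hne X hX hX0
      have e1 := eq_empty_of_rot_signData (hdisj X hX).1 (congrArg Prod.fst heq.1)
        (congrArg Prod.snd heq.1) g
      have e2 := eq_empty_of_rot_signData (hdisj X hX).2 (congrArg Prod.fst heq.2)
        (congrArg Prod.snd heq.2) g
      simp [e1, e2] at hg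
  · intro X hX hX0
    simp only [level]
    split_ifs with hf
    · have h1 := card_le_of_row (hrow X hX)
      have h2 := le_card_colorSet (c := c) hf.1 hf.2
      rw [Fintype.card_fin] at h1
      omega
    · have := hlow X hX hf
      obtain ⟨g, hg | hg⟩ := hne X hX hX0
      · have := weight_pos hk₁ hg
        omega
      · have := weight_pos hk₂ hg
        omega
  · intro X hX X' hX'0 hX'
    have hX'v : IsSignVector (N₁ + N₂) X' :=
      ⟨fun v hv => hX.1 v (hX' hv), fun v hv w hw => hX.2 v (hX' hv) w (hX' hw)⟩
    have hW := hWmono X X' hX'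
    simp only [level, label]
    by_cases hf : full X
    · rw [if_pos hf, if_pos hf]
      by_cases hf' : full X'
      · rw [if_pos hf', if_pos hf']
        have h1 := colorSet_mono (k₁ := k₁) (k₂ := k₂) (c := c) hW.1 hW.2
        have h2 := Finset.card_le_card h1
        have h3 := le_card_colorSet (c := c) hf'.1 hf'.2
        refine ⟨by omega, fun heq => ?_⟩
        rw [Finset.eq_of_subset_of_card_le h1 (by omega)]
      · rw [if_neg hf', if_neg hf']
        have := hlow X' hX'v hf'
        exact ⟨by omega, fun h => by omega⟩
    · have hf' : ¬ full X' := fun h => hf (hfullmono X X' hX' h)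
      rw [if_neg hf, if_neg hf', if_neg hf, if_neg hf']
      have h1 := weight_mono (k := k₁) hW.1
      have h2 := weight_mono (k := k₂) hW.2
      refine ⟨add_le_add h1.1 h2.1, fun heq => ?_⟩
      rw [h1.2 (by omega), h2.2 (by omega)]

end Kneser

end ListChain

/-! ### Colorings of products, greedy colorings and Zhu's conjecture for Kneser hypergraphs. -/

namespace Hypergraph

variable {α β : Type*} {H : Hypergraph α} {H₁ : Hypergraph α} {H₂ : Hypergraph β} {m p : ℕ}

theorem Colorable.exists_total (h : H.Colorable m) (hm : 0 < m) :
    ∃ c : α → Fin m, ∀ e ∈ E(H), ∃ x ∈ e, ∃ y ∈ e, c x ≠ c y := by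
  classical
  obtain ⟨c, hc⟩ := h
  refine ⟨fun a => if h : a ∈ V(H) then c ⟨a, h⟩ else ⟨0, hm⟩, fun e he => ?_⟩
  obtain ⟨x, y, hx, hy, hxy⟩ := hc e he
  exact ⟨x, hx, y, hy, by simpa using hxy⟩

theorem Colorable.of_total {c : α → Fin m}
    (hc : ∀ e ∈ E(H), ∃ x ∈ e, ∃ y ∈ e, c x ≠ c y) : H.Colorable m := by
  refine ⟨fun a => c a.1, fun e he => ?_⟩
  obtain ⟨x, hx, y, hy, hxy⟩ := hc e he
  exact ⟨⟨x, H.subset_vertexSet_of_mem_edgeSet' he hx⟩,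
    ⟨y, H.subset_vertexSet_of_mem_edgeSet' he hy⟩, hx, hy, hxy⟩

theorem Colorable.pos (h : H.Colorable m) (hV : V(H).Nonempty) : 0 < m := by
  obtain ⟨c, -⟩ := h
  obtain ⟨v, hv⟩ := hV
  exact (c ⟨v, hv⟩).pos

theorem Colorable.chromaticNumber_le (h : H.Colorable m) : H.chromaticNumber ≤ m :=
  Nat.sInf_le h

theorem Colorable.colorable_chromaticNumber (h : H.Colorable m) :
    H.Colorable H.chromaticNumber :=
  Nat.sInf_mem (s := {m | H.Colorable m}) ⟨m, h⟩

theorem Colorable.prod_left (h : H₁.Colorable m) (H₂ : Hypergraph β) :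
    (H₁.prod H₂).Colorable m := by
  obtain ⟨c, hc⟩ := h
  refine ⟨fun v => c ⟨v.1.1, v.2.1⟩, fun e he => ?_⟩
  obtain ⟨⟨x, hx⟩, ⟨y, hy⟩, hxe, hye, hxy⟩ := hc _ he.1
  obtain ⟨v, hv, rfl⟩ := hxe
  obtain ⟨w, hw, rfl⟩ := hye
  exact ⟨⟨v, (H₁.prod H₂).subset_vertexSet_of_mem_edgeSet' he hv⟩,
    ⟨w, (H₁.prod H₂).subset_vertexSet_of_mem_edgeSet' he hw⟩, hv, hw, hxy⟩

theorem Colorable.prod_right (h : H₂.Colorable m) (H₁ : Hypergraph α) :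
    (H₁.prod H₂).Colorable m := by
  obtain ⟨c, hc⟩ := h
  refine ⟨fun v => c ⟨v.1.2, v.2.2⟩, fun e he => ?_⟩
  obtain ⟨⟨x, hx⟩, ⟨y, hy⟩, hxe, hye, hxy⟩ := hc _ he.2
  obtain ⟨v, hv, rfl⟩ := hxe
  obtain ⟨w, hw, rfl⟩ := hye
  exact ⟨⟨v, (H₁.prod H₂).subset_vertexSet_of_mem_edgeSet' he hv⟩,
    ⟨w, (H₁.prod H₂).subset_vertexSet_of_mem_edgeSet' he hw⟩, hv, hw, hxy⟩

theorem IsUniform.exists_colorable (hH : H.IsUniform p) (hp : 2 ≤ p) (hV : V(H).Finite) :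
    ∃ m, H.Colorable m := by
  obtain ⟨m, ⟨f⟩⟩ := finite_iff_exists_equiv_fin.1 hV.to_subtype
  refine ⟨m, f, fun e he => ?_⟩
  have h1 : 1 < e.ncard := by rw [(hH e he).2]; omega
  obtain ⟨x, hx, y, hy, hxy⟩ := (Set.one_lt_ncard_iff_nontrivial_and_finite.1 h1).1
  have hsub := H.subset_vertexSet_of_mem_edgeSet' he
  exact ⟨⟨x, hsub hx⟩, ⟨y, hsub hy⟩, hx, hy, fun h => hxy (congrArg Subtype.val (f.injective h))⟩

theorem IsUniform.colorable_of_vertexSet_eq_empty (hH : H.IsUniform p) (hp : p ≠ 0)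
    (hV : V(H) = ∅) (m : ℕ) : H.Colorable m := by
  refine ⟨fun v => absurd v.2 (by simp [hV]), fun e he => ?_⟩
  have h0 : e ⊆ ∅ := hV ▸ H.subset_vertexSet_of_mem_edgeSet' he
  have h1 := (hH e he).2
  rw [Set.subset_empty_iff.1 h0, Set.ncard_empty] at h1
  exact absurd h1.symm hp

theorem colorable_one (hE : E(H) = ∅) : H.Colorable 1 :=
  ⟨fun _ => 0, fun e he => by simp [hE] at he⟩

theorem chromaticNumber_prod_le (h₁ : ∃ m, H₁.Colorable m) (h₂ : ∃ m, H₂.Colorable m) :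
    (H₁.prod H₂).chromaticNumber ≤ min H₁.chromaticNumber H₂.chromaticNumber := by
  obtain ⟨m₁, h₁⟩ := h₁
  obtain ⟨m₂, h₂⟩ := h₂
  exact le_min (h₁.colorable_chromaticNumber.prod_left H₂).chromaticNumber_le
    (h₂.colorable_chromaticNumber.prod_right H₁).chromaticNumber_le

theorem kneser_isUniform (p n k : ℕ) : (kneser p n k).IsUniform p :=
  fun e he => ⟨Set.toFinite e, he.2.1⟩

theorem range_mem_kneser [NeZero p] {n k : ℕ} (hk : 1 ≤ k) {A : ZMod p → Finset (Fin n)}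
    (hA : ∀ g, (A g).card = k) (hd : ∀ g g', g ≠ g' → Disjoint (A g) (A g')) :
    Set.range A ∈ E(kneser p n k) := by
  have hinj : Function.Injective A := by
    intro g g' h
    by_contra hne
    have h1 := hd g g' hne
    rw [h, disjoint_self] at h1
    have h2 := hA g'
    rw [h1, Finset.bot_eq_empty, Finset.card_empty] at h2
    omega
  refine ⟨?_, ?_, ?_⟩
  · rintro _ ⟨g, rfl⟩
    exact hA g
  · rw [← Set.image_univ, Set.ncard_image_of_injective _ hinj, Set.ncard_univ, Nat.card_zmod]
  · rintro _ ⟨g, rfl⟩ _ ⟨g', rfl⟩ hne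
    exact hd g g' fun h => hne (by rw [h])

theorem card_biUnion_of_mem_kneser {n k : ℕ} {e : Set (Finset (Fin n))}
    (he : e ∈ E(kneser p n k)) (hfin : e.Finite) :
    (hfin.toFinset.biUnion id).card = p * k := by
  have hk : ∀ A ∈ hfin.toFinset, (id A).card = k := fun A hA => he.1 (hfin.mem_toFinset.1 hA)
  rw [Finset.card_biUnion (t := id) fun A hA B hB h =>
      he.2.2 A (hfin.mem_toFinset.1 hA) B (hfin.mem_toFinset.1 hB) h,
    Finset.sum_congr rfl hk, Finset.sum_const, ← Set.ncard_eq_toFinset_card e hfin, he.2.1,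
    smul_eq_mul]

/-- The greedy coloring of a Kneser hypergraph. -/
theorem kneser_colorable {n k t : ℕ} (hp : 2 ≤ p) (hk : 1 ≤ k)
    (hn : n + 1 ≤ p * k + t * (p - 1)) : (kneser p n k).Colorable (t + 1) := by
  classical
  let μ : Finset (Fin n) → ℕ := fun A => if h : A.Nonempty then (A.min' h).val else 0
  -- The color is the block of `p - 1` consecutive points containing the minimum, all blocks from
  -- number `t` on sharing one color. Disjoint sets have distinct minima, so an early block cannot
  -- serve `p` of them; the final part has fewer than `p * k` points.
  refine Colorable.of_total (c := fun A => ⟨min (μ A / (p - 1)) t, by omega⟩) fun e he => ?_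
  by_contra hmono
  push Not at hmono
  have ⟨hek, hep, hed⟩ := he
  have hfin : e.Finite := Set.toFinite e
  have hne : ∀ A ∈ e, A.Nonempty := fun A hA => Finset.card_pos.1 (by rw [hek hA]; exact hk)
  have hμ : ∀ A (hA : A ∈ e), μ A = (A.min' (hne A hA)).val := fun A hA => dif_pos (hne A hA)
  obtain ⟨A₀, hA₀⟩ : e.Nonempty := by
    rw [← Set.ncard_pos hfin, hep]; omega
  have hcol : ∀ A ∈ e, min (μ A / (p - 1)) t = min (μ A₀ / (p - 1)) t := fun A hA => by
    simpa using hmono A hA A₀ hA₀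
  by_cases hlt : μ A₀ / (p - 1) < t
  · have hdiv : ∀ A ∈ e, μ A / (p - 1) = μ A₀ / (p - 1) := fun A hA => by
      have := hcol A hA
      omega
    have hinj : Set.InjOn (fun A => μ A % (p - 1)) e := by
      intro A hA B hB hAB
      by_contra hne'
      have h1 : μ A = μ B := by
        rw [← Nat.div_add_mod (μ A) (p - 1), ← Nat.div_add_mod (μ B) (p - 1), hdiv A hA, hdiv B hB]
        exact congrArg _ hAB
      rw [hμ A hA, hμ B hB] at h1
      have h2 := Fin.ext h1
      refine Finset.disjoint_left.1 (hed A hA B hB hne') (Finset.min'_mem A (hne A hA)) ?_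
      rw [h2]
      exact Finset.min'_mem B (hne B hB)
    have hcard := Set.ncard_le_ncard_of_injOn (t := (Finset.range (p - 1) : Set ℕ)) _
      (fun A _ => by simpa using Nat.mod_lt _ (by omega)) hinj (Finset.finite_toSet _)
    rw [hep, Set.ncard_coe_finset, Finset.card_range] at hcard
    omega
  · have hge : ∀ A ∈ e, ∀ a ∈ A, t * (p - 1) ≤ a.val := fun A hA a ha => by
      have h1 := hcol A hA
      have h2 : t ≤ μ A / (p - 1) := by omega
      have h3 := (Nat.le_div_iff_mul_le (by omega)).1 h2
      rw [hμ A hA] at h3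
      exact h3.trans (Finset.min'_le A a ha)
    have hsum := card_biUnion_of_mem_kneser he hfin
    have hle : (hfin.toFinset.biUnion id).card ≤ n - t * (p - 1) := by
      rw [← Nat.card_Ico, ← Finset.card_image_of_injective _ Fin.val_injective]
      refine Finset.card_le_card fun x hx => ?_
      obtain ⟨a, ha, rfl⟩ := Finset.mem_image.1 hx
      obtain ⟨A, hA, ha⟩ := Finset.mem_biUnion.1 ha
      exact Finset.mem_Ico.2 ⟨hge A (hfin.mem_toFinset.1 hA) a ha, a.2⟩
    have : 1 ≤ p * k := Nat.mul_pos (by omega) hk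
    omega

theorem kneser_edgeSet_eq_empty {n k : ℕ} (hp : 2 ≤ p) (h : k = 0 ∨ n < p * k) :
    E(kneser p n k) = ∅ := by
  classical
  refine Set.eq_empty_of_forall_notMem fun e he => ?_
  have ⟨hek, hep, hed⟩ := he
  have hfin : e.Finite := Set.toFinite e
  rcases h with rfl | h
  · have hsub : e ⊆ {∅} := fun A hA => Finset.card_eq_zero.1 (hek hA)
    have := Set.ncard_le_ncard hsub
    rw [hep, Set.ncard_singleton] at this
    omega
  · have hsum := card_biUnion_of_mem_kneser he hfin
    have := Finset.card_le_univ (hfin.toFinset.biUnion id)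
    rw [hsum, Fintype.card_fin] at this
    omega

/-- The Tucker bound for the smaller of the two surpluses is exactly the hypothesis of the greedy
coloring for the factor attaining it. -/
theorem kneser_colorable_of_prod [Fact p.Prime] {n₁ k₁ n₂ k₂ : ℕ} (hk₁ : 1 ≤ k₁) (hk₂ : 1 ≤ k₂)
    (hn₁ : p * k₁ ≤ n₁) (hn₂ : p * k₂ ≤ n₂) (hm : 0 < m)
    (h : ((kneser p n₁ k₁).prod (kneser p n₂ k₂)).Colorable m) :
    (kneser p n₁ k₁).Colorable m ∨ (kneser p n₂ k₂).Colorable m := by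
  have hp := (Fact.out : p.Prime).two_le
  obtain ⟨c, hc⟩ := h.exists_total hm
  have hbound := ListChain.le_mul_of_coloring (p := p) (n₁ := n₁) (n₂ := n₂)
    (d := min (n₁ + 1 - p * k₁) (n₂ + 1 - p * k₂)) hk₁ hk₂ (by omega) (by omega) (by omega) c ?_
  · obtain ⟨t, rfl⟩ := Nat.exists_eq_add_of_le' hm
    rw [Nat.add_sub_cancel] at hbound
    rcases min_le_iff.1 hbound with h | h
    · exact Or.inl (kneser_colorable hp hk₁ (by omega))
    · exact Or.inr (kneser_colorable hp hk₂ (by omega))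
  · intro A B hA hB hAd hBd j
    by_contra hall
    push Not at hall
    have he : Set.range (fun g => (A g, B g)) ∈
        E((kneser p n₁ k₁).prod (kneser p n₂ k₂)) := by
      constructor
      · rw [← Set.range_comp]
        exact range_mem_kneser hk₁ hA hAd
      · rw [← Set.range_comp]
        exact range_mem_kneser hk₂ hB hBd
    obtain ⟨_, ⟨g, rfl⟩, _, ⟨g', rfl⟩, hne⟩ := hc _ he
    exact hne ((hall g).trans (hall g').symm)

/-- Zhu's conjecture for Kneser hypergraphs of prime uniformity. -/
theorem chromaticNumber_prod_kneser (p : ℕ) [Fact p.Prime] (n₁ k₁ n₂ k₂ : ℕ) :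
    ((kneser p n₁ k₁).prod (kneser p n₂ k₂)).chromaticNumber =
      min (kneser p n₁ k₁).chromaticNumber (kneser p n₂ k₂).chromaticNumber := by
  have hp := (Fact.out : p.Prime).two_le
  have hex := fun n k => (kneser_isUniform p n k).exists_colorable hp (Set.toFinite _)
  refine le_antisymm (chromaticNumber_prod_le (hex n₁ k₁) (hex n₂ k₂)) ?_
  obtain ⟨m, hm⟩ := hex n₁ k₁
  have hχ := (hm.prod_left (kneser p n₂ k₂)).colorable_chromaticNumber
  set χ := ((kneser p n₁ k₁).prod (kneser p n₂ k₂)).chromaticNumber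
  suffices h : (kneser p n₁ k₁).Colorable χ ∨ (kneser p n₂ k₂).Colorable χ by
    rcases h with h | h
    · exact (min_le_left _ _).trans h.chromaticNumber_le
    · exact (min_le_right _ _).trans h.chromaticNumber_le
  have hmono : ∀ {n k}, (kneser p n k).Colorable 1 → 0 < χ → (kneser p n k).Colorable χ :=
    fun ⟨c, hc⟩ _ => ⟨fun v => ⟨0, ‹_›⟩, fun e he => by
      obtain ⟨x, y, -, -, hxy⟩ := hc e he
      exact absurd (Subsingleton.elim _ _) hxy⟩
  have hempty := fun n k hV =>
    (kneser_isUniform p n k).colorable_of_vertexSet_eq_empty (by omega) hV χ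
  rcases Set.eq_empty_or_nonempty V(kneser p n₁ k₁) with hV₁ | hV₁
  · exact Or.inl (hempty _ _ hV₁)
  rcases Set.eq_empty_or_nonempty V(kneser p n₂ k₂) with hV₂ | hV₂
  · exact Or.inr (hempty _ _ hV₂)
  have hpos : 0 < χ := hχ.pos (hV₁.prod hV₂)
  by_cases h₁ : k₁ = 0 ∨ n₁ < p * k₁
  · exact Or.inl (hmono (colorable_one (kneser_edgeSet_eq_empty hp h₁)) hpos)
  by_cases h₂ : k₂ = 0 ∨ n₂ < p * k₂
  · exact Or.inr (hmono (colorable_one (kneser_edgeSet_eq_empty hp h₂)) hpos)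
  exact kneser_colorable_of_prod (by omega) (by omega) (by omega) (by omega) hpos hχ

end Hypergraph

/-! ### Mesh of barycentric subdivisions. -/

namespace ListChain

section Mesh

variable {E : Type*} [NormedAddCommGroup E] [NormedSpace ℝ E]

/-- The barycenter of a list of points. -/
noncomputable def bary (l : List E) : E := (l.length : ℝ)⁻¹ • l.sum

theorem bary_eq_sum (l : List E) : bary l = ∑ i : Fin l.length, (l.length : ℝ)⁻¹ • l[i] := by
  rw [bary, ← Finset.smul_sum]
  exact congrArg _ (Fin.sum_univ_getElem l).symm

theorem bary_mem {K : Set E} (hK : Convex ℝ K) {l : List E} (hl : l ≠ []) (h : ∀ x ∈ l, x ∈ K) :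
    bary l ∈ K := by
  have hpos : (l.length : ℝ) ≠ 0 := by
    rw [Nat.cast_ne_zero]; exact fun h => hl (List.length_eq_zero_iff.1 h)
  rw [bary_eq_sum]
  exact hK.sum_mem (fun _ _ => by positivity) (by simp [hpos]) fun i _ => h _ (List.getElem_mem _)

theorem dist_bary_le {l : List E} {δ : ℝ} (hd : ∀ x ∈ l, ∀ y ∈ l, dist x y ≤ δ) {n : ℕ}
    (hn : l.length ≤ n) {x : E} (hx : x ∈ l) : dist x (bary l) ≤ (1 - (n : ℝ)⁻¹) * δ := by
  obtain ⟨i₀, hi₀, rfl⟩ := List.getElem_of_mem hx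
  have hpos : 0 < l.length := by omega
  have hpos' : (0 : ℝ) < l.length := Nat.cast_pos.2 hpos
  have hδ : 0 ≤ δ := dist_nonneg.trans (hd _ hx _ hx)
  have h1 : l[i₀] - bary l = ∑ i : Fin l.length, (l.length : ℝ)⁻¹ • (l[i₀] - l[i]) := by
    rw [bary_eq_sum]
    simp only [smul_sub, Finset.sum_sub_distrib, Finset.sum_const, Finset.card_univ,
      Fintype.card_fin]
    congr 1
    rw [← Nat.cast_smul_eq_nsmul ℝ, smul_smul, mul_inv_cancel₀ hpos'.ne', one_smul]
  rw [dist_eq_norm, h1]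
  calc ‖∑ i : Fin l.length, (l.length : ℝ)⁻¹ • (l[i₀] - l[i])‖
      ≤ ∑ i : Fin l.length, ‖(l.length : ℝ)⁻¹ • (l[i₀] - l[i])‖ := norm_sum_le _ _
    -- The vertex is at distance zero from itself; dropping that term gains the factor below `1`.
    _ = ∑ i ∈ Finset.univ.erase (⟨i₀, hi₀⟩ : Fin l.length),
          ‖(l.length : ℝ)⁻¹ • (l[i₀] - l[i])‖ := by
        rw [Finset.sum_erase]; simp
    _ ≤ ∑ i ∈ Finset.univ.erase (⟨i₀, hi₀⟩ : Fin l.length), (l.length : ℝ)⁻¹ * δ := by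
        refine Finset.sum_le_sum fun i _ => ?_
        rw [norm_smul, Real.norm_of_nonneg (by positivity), ← dist_eq_norm]
        exact mul_le_mul_of_nonneg_left (hd _ hx _ (List.getElem_mem _)) (by positivity)
    _ = (1 - (l.length : ℝ)⁻¹) * δ := by
        rw [Finset.sum_const, Finset.card_erase_of_mem (Finset.mem_univ _), Finset.card_univ,
          Fintype.card_fin, nsmul_eq_mul, Nat.cast_sub hpos, Nat.cast_one]
        field_simp
    _ ≤ (1 - (n : ℝ)⁻¹) * δ := by
        refine mul_le_mul_of_nonneg_right (sub_le_sub_left ?_ 1) hδ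
        exact inv_anti₀ hpos' (Nat.cast_le.2 hn)

theorem dist_bary_bary_le {l : List E} {δ : ℝ} (hd : ∀ x ∈ l, ∀ y ∈ l, dist x y ≤ δ) {n : ℕ}
    (hn : l.length ≤ n) {l₁ l₂ : List E} (h₁ : l₁ ≠ []) (h₂₁ : l₁.Sublist l₂) (h₂ : l₂.Sublist l) :
    dist (bary l₁) (bary l₂) ≤ (1 - (n : ℝ)⁻¹) * δ :=
  bary_mem (convex_closedBall (bary l₂) _) h₁ fun _ hx =>
    dist_bary_le (fun x hx y hy => hd x (h₂.subset hx) y (h₂.subset hy)) (h₂.length_le.trans hn)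
      (h₂₁.subset hx)

end Mesh

end ListChain

/-- The vertices of a join are pairs. -/
def joinVertexEquiv (G : Type*) (n : ℕ) : JoinVertex G n ≃ Fin n × G where
  toFun v := (v.level, v.elt)
  invFun v := ⟨v.1, v.2⟩
  left_inv _ := rfl
  right_inv _ := rfl

instance (G : Type*) [Fintype G] (n : ℕ) : Fintype (JoinVertex G n) :=
  Fintype.ofEquiv _ (joinVertexEquiv G n).symm

namespace ListChain

/-! ### A Borsuk–Ulam theorem for the join of copies of `ℤ/p`. -/

section JoinRealization

variable {p n : ℕ}

/-- The ambient space of the polyhedron of the `n`-fold join of `ℤ/p`. -/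
abbrev JoinAmbient (p n : ℕ) : Type := JoinVertex (Multiplicative (ZMod p)) n → ℝ

/-- The polyhedron of the `n`-fold join of `ℤ/p`. -/
abbrev JoinSpace (p n : ℕ) : Type := (joinPower (Multiplicative (ZMod p)) n).Space

/-- The simplex spanned by a set of vertices. -/
def simplexOf (s : Finset (JoinVertex (Multiplicative (ZMod p)) n)) : Set (JoinAmbient p n) :=
  {x | (∀ v, 0 ≤ x v) ∧ (∀ v, v ∉ s → x v = 0) ∧ ∑ v ∈ s, x v = 1}

theorem convex_simplexOf (s : Finset (JoinVertex (Multiplicative (ZMod p)) n)) :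
    Convex ℝ (simplexOf s) := by
  intro x hx y hy a b ha hb hab
  refine ⟨fun v => ?_, fun v hv => ?_, ?_⟩
  · exact add_nonneg (mul_nonneg ha (hx.1 v)) (mul_nonneg hb (hy.1 v))
  · simp [hx.2.1 v hv, hy.2.1 v hv]
  · simp [Finset.sum_add_distrib, ← Finset.mul_sum, hx.2.2, hy.2.2, hab]

variable [Fact p.Prime]

/-- The linear action of `ℤ/p` on the ambient space. -/
noncomputable def ambientShift (t : ZMod p) : JoinAmbient p n →ₗ[ℝ] JoinAmbient p n :=
  LinearMap.funLeft ℝ ℝ fun v => (Multiplicative.ofAdd t)⁻¹ • v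

theorem ambientShift_apply (t : ZMod p) (x : JoinAmbient p n) (v) :
    ambientShift t x v = x ((Multiplicative.ofAdd t)⁻¹ • v) := rfl

theorem dist_ambientShift_le (t : ZMod p) (x y : JoinAmbient p n) :
    dist (ambientShift t x) (ambientShift t y) ≤ dist x y :=
  (dist_pi_le_iff dist_nonneg).2 fun _ => dist_le_pi_dist x y _

theorem bary_ambientShift (t : ZMod p) (l : List (JoinAmbient p n)) :
    bary (l.map (ambientShift t)) = ambientShift t (bary l) := by
  rw [bary, bary, map_smul, map_list_sum, List.length_map]

/-- The ordered simplices with `i` vertices that lie in a face of the join and have diameter at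
most `δ`. -/
def meshFaces (p n : ℕ) [Fact p.Prime] (δ : ℝ) (i : ℕ) : Set (List (JoinAmbient p n)) :=
  {l | l.length = i ∧ (∃ s : Finset (JoinVertex (Multiplicative (ZMod p)) n),
    (∀ v ∈ s, ∀ w ∈ s, v.level = w.level → v = w) ∧ ∀ x ∈ l, x ∈ simplexOf s) ∧
    ∀ x ∈ l, ∀ y ∈ l, dist x y ≤ δ}

theorem sublist_mem_meshFaces {δ : ℝ} {i : ℕ} {l l' : List (JoinAmbient p n)}
    (hl : l ∈ meshFaces p n δ i) (h : l'.Sublist l) : l' ∈ meshFaces p n δ l'.length := by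
  obtain ⟨-, ⟨s, hs, hls⟩, hd⟩ := hl
  exact ⟨rfl, ⟨s, hs, fun x hx => hls x (h.subset hx)⟩,
    fun x hx y hy => hd x (h.subset hx) y (h.subset hy)⟩

/-- The point of the polyhedron that corresponds to a vertex. -/
noncomputable def vertexPoint (p n : ℕ) (v : ℕ × ZMod p) : JoinAmbient p n := fun w =>
  if w.level.val = v.1 ∧ w.elt = Multiplicative.ofAdd v.2 then 1 else 0

theorem vertexPoint_joinShift (t : ZMod p) (v : ℕ × ZMod p) :
    vertexPoint p n (joinShift t v) = ambientShift t (vertexPoint p n v) := by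
  funext w
  have h1 : ((Multiplicative.ofAdd t)⁻¹ • w).level = w.level := rfl
  have h2 : ((Multiplicative.ofAdd t)⁻¹ • w).elt = (Multiplicative.ofAdd t)⁻¹ * w.elt := rfl
  have h3 : (Multiplicative.ofAdd t)⁻¹ * w.elt = Multiplicative.ofAdd v.2 ↔
      w.elt = Multiplicative.ofAdd (v.2 + t) := by
    rw [inv_mul_eq_iff_eq_mul, add_comm, ofAdd_add]
  rw [ambientShift_apply]
  unfold vertexPoint joinShift
  rw [h1, h2]
  exact if_congr (and_congr_right fun _ => h3.symm) rfl rfl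

theorem map_vertexPoint_mem_meshFaces {i : ℕ} {l : List (ℕ × ZMod p)} (hl : l ∈ joinFaces p n i) :
    l.map (vertexPoint p n) ∈ meshFaces p n 1 i := by
  classical
  have hsv := isSignVector_toFinset hl
  refine ⟨by simp [hl.1], ⟨Finset.univ.filter fun w => (w.level.val, w.elt.toAdd) ∈ l, ?_, ?_⟩, ?_⟩
  · rintro ⟨j, g⟩ hv ⟨j', g'⟩ hw (rfl : j = j')
    simp only [Finset.mem_filter, Finset.mem_univ, true_and] at hv hw
    have := hsv.2 _ (List.mem_toFinset.2 hv) _ (List.mem_toFinset.2 hw) rfl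
    rw [JoinVertex.mk.injEq]
    exact ⟨rfl, (Prod.mk.inj this).2⟩
  · intro x hx
    obtain ⟨⟨j, g⟩, hv, rfl⟩ := List.mem_map.1 hx
    refine ⟨fun w => ?_, fun w hw => ?_, ?_⟩
    · unfold vertexPoint; split_ifs <;> norm_num
    · unfold vertexPoint
      refine if_neg fun h => hw ?_
      simp only [Finset.mem_filter, Finset.mem_univ, true_and]
      rw [h.1, h.2]
      exact hv
    · have hj : j < n := hl.2.2 _ hv
      rw [Finset.sum_eq_single_of_mem ⟨⟨j, hj⟩, Multiplicative.ofAdd g⟩ (by simpa using hv)]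
      · simp [vertexPoint]
      · rintro ⟨j', g'⟩ - hne
        refine if_neg fun h => hne ?_
        rw [JoinVertex.mk.injEq]
        exact ⟨Fin.ext h.1, h.2⟩
  · intro x hx y hy
    obtain ⟨v, hv, rfl⟩ := List.mem_map.1 hx
    obtain ⟨w, hw, rfl⟩ := List.mem_map.1 hy
    refine (dist_pi_le_iff zero_le_one).2 fun u => ?_
    unfold vertexPoint
    split_ifs <;> simp

/-- Iterated barycentric subdivision of the tower in the join. -/
theorem exists_tower_mesh (p n : ℕ) [Fact p.Prime] (r : ℕ) :
    ∃ h : ℕ → List (JoinAmbient p n) →₀ ZMod p, IsTower (fun t => ambientShift t) n h ∧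
      ∀ i ≤ n, h i ∈ Finsupp.supported (ZMod p) (ZMod p)
        (meshFaces p n ((1 - (n : ℝ)⁻¹) ^ r) i) := by
  induction r with
  | zero =>
    refine ⟨_, (isTower_joinTower n).mapChain (f := vertexPoint p n) vertexPoint_joinShift,
      fun i hi => map_mem_supported (fun l hl => ?_) (joinTower_mem_supported_of_le hi)⟩
    rw [mapChain_single, pow_zero]
    exact Finsupp.single_mem_supported _ _ (map_vertexPoint_mem_meshFaces hl)
  | succ r ih =>
    obtain ⟨h, H, hs⟩ := ih
    refine ⟨_, H.sd (F := {l | ∃ i, l ∈ meshFaces p n ((1 - (n : ℝ)⁻¹) ^ r) i}) (b := bary)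
      ?_ ?_ ?_, ?_⟩
    · rintro l ⟨i, hl⟩ l' hl'
      exact ⟨_, sublist_mem_meshFaces hl hl'⟩
    · exact fun t l _ _ => bary_ambientShift t l
    · intro i hi
      refine Finsupp.supported_mono ?_ (hs i hi)
      exact fun l hl => ⟨i, hl⟩
    · intro i hi
      refine map_mem_supported (fun l hl => ?_) (hs i hi)
      refine Finsupp.supported_mono ?_ (sd_mem_supported bary i l hl.1)
      rintro _ ⟨L, rfl, hL, hP, hLl⟩
      obtain ⟨hlen, ⟨s, hs, hls⟩, hd⟩ := hl
      have hn : l.length ≤ n := hlen.trans_le hi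
      refine ⟨by simp [hL], ⟨s, hs, fun x hx => ?_⟩, ?_⟩
      · obtain ⟨q, hq, rfl⟩ := List.mem_map.1 hx
        exact bary_mem (convex_simplexOf s) (hLl q hq).2 fun x hx =>
          hls x ((hLl q hq).1.subset hx)
      -- Any two faces in a flag are nested, so `dist_bary_bary_le` applies to them in one order or
      -- the other.
      · have hR : ∀ q ∈ L, ∀ q' ∈ L, dist (bary q) (bary q') ≤ (1 - (n : ℝ)⁻¹) ^ (r + 1) := by
          rw [pow_succ']
          have : Std.Symm fun q q' : List (JoinAmbient p n) => dist (bary q) (bary q') ≤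
              (1 - (n : ℝ)⁻¹) * (1 - (n : ℝ)⁻¹) ^ r := ⟨fun q q' h => by rwa [dist_comm]⟩
          refine fun q hq q' hq' => List.Pairwise.forall_of_forall
            (R := fun q q' => dist (bary q) (bary q') ≤
              (1 - (n : ℝ)⁻¹) * (1 - (n : ℝ)⁻¹) ^ r) (fun q hq => ?_) ?_ hq hq'
          · exact dist_bary_bary_le hd hn (hLl q hq).2 (List.Sublist.refl q) (hLl q hq).1
          · refine (List.Pairwise.and_mem.1 hP).imp fun {q q'} h => ?_
            rw [dist_comm]
            exact dist_bary_bary_le hd hn (hLl q' h.2.1).2 h.2.2 (hLl q h.1).1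
        intro x hx y hy
        obtain ⟨q, hq, rfl⟩ := List.mem_map.1 hx
        obtain ⟨q', hq', rfl⟩ := List.mem_map.1 hy
        exact hR q hq q' hq'

theorem isCompact_geometricRealization {ι : Type*} [Finite ι] (K : PreAbstractSimplicialComplex ι) :
    IsCompact (geometricRealization K) := by
  cases nonempty_fintype ι
  have hU : geometricRealization K = ⋃ s ∈ K.faces, {x : ι → ℝ | (∀ i, 0 ≤ x i) ∧
      (∀ i, i ∉ s → x i = 0) ∧ ∑ i ∈ s, x i = 1} := by
    ext x
    simp only [geometricRealization, Set.mem_ofPred_eq, Set.mem_iUnion, exists_prop]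
    constructor
    · rintro ⟨h0, s, hs, h⟩
      exact ⟨s, hs, h0, h⟩
    · rintro ⟨s, hs, h0, h⟩
      exact ⟨h0, s, hs, h⟩
  have hclosed : IsClosed (geometricRealization K) := by
    rw [hU]
    refine (Set.toFinite _).isClosed_biUnion fun s _ => ?_
    have e : {x : ι → ℝ | (∀ i, 0 ≤ x i) ∧ (∀ i, i ∉ s → x i = 0) ∧ ∑ i ∈ s, x i = 1} =
        (⋂ i, {x | 0 ≤ x i}) ∩ ((⋂ i, ⋂ _ : i ∉ s, {x | x i = 0}) ∩ {x | ∑ i ∈ s, x i = 1}) := by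
      ext x; simp
    rw [e]
    refine IsClosed.inter ?_ (IsClosed.inter ?_ ?_)
    · exact isClosed_iInter fun i => isClosed_le continuous_const (continuous_apply i)
    · exact isClosed_iInter fun i => isClosed_iInter fun _ =>
        isClosed_eq (continuous_apply i) continuous_const
    · exact isClosed_eq (continuous_finsetSum _ fun i _ => continuous_apply i) continuous_const
  refine (isCompact_Icc (a := (0 : ι → ℝ)) (b := 1)).of_isClosed_subset hclosed ?_
  rintro x ⟨h0, s, -, hs, hsum⟩
  refine ⟨h0, fun i => ?_⟩
  by_cases hi : i ∈ s
  · exact (Finset.single_le_sum (fun i _ => h0 i) hi).trans hsum.le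
  · rw [hs i hi]
    exact zero_le_one

/-- A Borsuk–Ulam theorem for `ℤ/p`: an equivariant map from the `n`-fold join of `ℤ/p` to matrices
with `m + 1` rows and column sums `1` takes a matrix with equal columns as value if
`n > m * (p - 1)`. -/
theorem le_of_equivariant_matrix {m : ℕ}
    (M : JoinSpace p n → Fin (m + 1) → ZMod p → ℝ)
    (hcont : ∀ j i, Continuous fun x => M x j i)
    (heq : ∀ t x j i, M (Multiplicative.ofAdd t • x) j i = M x j (i - t))
    (hcol : ∀ x i, ∑ j, M x j i = 1) (hne : ∀ x, ∃ j i i', M x j i ≠ M x j i') :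
    n ≤ m * (p - 1) := by
  classical
  by_contra hlt
  rw [not_le] at hlt
  have hp : (0 : ℝ) < p := Nat.cast_pos.2 (Fact.out : p.Prime).pos
  have : CompactSpace (JoinSpace p n) := isCompact_iff_compactSpace.1 (isCompact_geometricRealization _)
  -- The points where an entry exceeds the mean of its row. The last row is left out: column sums
  -- determine it from the others. These sets cover because some row is not constant, and no point
  -- lies in all the sets of a row.
  let U : Fin m × ZMod p → Set (JoinSpace p n) := fun v =>
    {x | ∑ i, M x v.1.castSucc i < p * M x v.1.castSucc v.2}
  have hUopen : ∀ v, IsOpen (U v) := fun v =>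
    isOpen_lt (continuous_finsetSum _ fun i _ => hcont v.1.castSucc i)
      (continuous_const.mul (hcont v.1.castSucc v.2))
  have hconst : ∀ f : ZMod p → ℝ, (∀ i, p * f i ≤ ∑ i', f i') → ∀ i, p * f i = ∑ i', f i' := by
    intro f hf i
    refine (Finset.sum_eq_sum_iff_of_le (s := Finset.univ) fun i _ => hf i).1 ?_ i
      (Finset.mem_univ i)
    rw [← Finset.mul_sum, Finset.sum_const, Finset.card_univ, ZMod.card, nsmul_eq_mul]
  have hcover : (Set.univ : Set (JoinSpace p n)) ⊆ ⋃ v, U v := by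
    intro x _
    by_contra hx
    simp only [U, Set.mem_iUnion, Set.mem_ofPred_eq, not_exists, not_lt, Prod.forall] at hx
    have h1 : ∀ (j : Fin m) i i', M x j.castSucc i = M x j.castSucc i' := fun j i i' =>
      mul_left_cancel₀ hp.ne' ((hconst _ (hx j) i).trans (hconst _ (hx j) i').symm)
    obtain ⟨j, i, i', hj⟩ := hne x
    apply hj
    induction j using Fin.lastCases with
    | cast j => exact h1 j i i'
    | last =>
      have h2 := (hcol x i).trans (hcol x i').symm
      rw [Fin.sum_univ_castSucc, Fin.sum_univ_castSucc,
        Finset.sum_congr rfl fun j _ => h1 j i i'] at h2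
      exact add_left_cancel h2
  have hrow : ∀ (x : JoinSpace p n) j, ∃ i, x ∉ U (j, i) := by
    intro x j
    by_contra hall
    push Not at hall
    have := Finset.sum_lt_sum_of_nonempty (s := (Finset.univ : Finset (ZMod p)))
      Finset.univ_nonempty
      (f := fun _ => ∑ i, M x j.castSucc i) (g := fun i => p * M x j.castSucc i)
      fun i _ => hall i
    simp only [← Finset.mul_sum, Finset.sum_const, Finset.card_univ, ZMod.card, nsmul_eq_mul,
      lt_self_iff_false] at this
  obtain ⟨δ, hδ, hball⟩ := lebesgue_number_lemma_of_metric isCompact_univ hUopen hcover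
  have hq : (1 - (n : ℝ)⁻¹) < 1 := by
    have : (0 : ℝ) < n := Nat.cast_pos.2 (by omega)
    have : (0 : ℝ) < (n : ℝ)⁻¹ := by positivity
    linarith
  obtain ⟨r, hr⟩ := exists_pow_lt_of_lt_one hδ hq
  obtain ⟨h, H, hs⟩ := exists_tower_mesh p n r
  set ε := (1 - (n : ℝ)⁻¹) ^ r
  -- Requiring a whole `δ`-ball serves two ends: the Lebesgue number makes `S l` nonempty, and in a
  -- simplex of diameter below `δ` every vertex lies in all the sets recorded by `S l`, so no row is
  -- complete. The level is `(S l).card`, at most `m * (p - 1) < n`.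
  let S : List (JoinAmbient p n) → Finset (Fin m × ZMod p) := fun l =>
    Finset.univ.filter fun v => ∃ x ∈ l, ∀ y : JoinSpace p n, dist x y.1 < δ → y ∈ U v
  have hmemS : ∀ l v, v ∈ S l ↔ ∃ x ∈ l, ∀ y : JoinSpace p n, dist x y.1 < δ → y ∈ U v := by
    intro l v
    simp [S]
  have hX : ∀ {i : ℕ} {l : List (JoinAmbient p n)}, l ∈ meshFaces p n ε i → ∀ x ∈ l,
      x ∈ geometricRealization
        (joinPower (Multiplicative (ZMod p)) n).toPreAbstractSimplicialComplex := by
    rintro i l ⟨-, ⟨s, hs, hls⟩, -⟩ x hx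
    obtain ⟨h0, h1, h2⟩ := hls x hx
    refine ⟨h0, s, ⟨?_, hs⟩, h1, h2⟩
    rw [Finset.nonempty_iff_ne_empty]
    rintro rfl
    simp at h2
  have hSne : ∀ {i : ℕ} {l : List (JoinAmbient p n)}, l ∈ meshFaces p n ε i → l ≠ [] →
      (S l).Nonempty := by
    intro i l hl hl0
    obtain ⟨x, hx⟩ := List.exists_mem_of_ne_nil l hl0
    obtain ⟨v, hv⟩ := hball ⟨x, hX hl x hx⟩ (Set.mem_univ _)
    refine ⟨v, (hmemS l v).2 ⟨x, hx, fun y hy => hv ?_⟩⟩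
    rw [Metric.mem_ball, dist_comm]
    exact hy
  have hSrow : ∀ {i : ℕ} {l : List (JoinAmbient p n)}, l ∈ meshFaces p n ε i → l ≠ [] →
      ∀ j, ∃ g, (j, g) ∉ S l := by
    intro i l hl hl0 j
    obtain ⟨x, hx⟩ := List.exists_mem_of_ne_nil l hl0
    obtain ⟨g, hg⟩ := hrow ⟨x, hX hl x hx⟩ j
    refine ⟨g, fun hmem => hg ?_⟩
    obtain ⟨y, hy, hyU⟩ := (hmemS l (j, g)).1 hmem
    exact hyU _ ((hl.2.2 y hy x hx).trans_lt hr)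
  have hSshift : ∀ t l, S (l.map (ambientShift t)) = colShift t (S l) := by
    have hU : ∀ t (y : JoinSpace p n) j g, Multiplicative.ofAdd t • y ∈ U (j, g) ↔ y ∈ U (j, g - t) := by
      intro t y j g
      simp only [U, Set.mem_ofPred_eq, heq]
      have := Equiv.sum_comp (Equiv.subRight t) (M y j.castSucc)
      simp only [Equiv.subRight_apply] at this
      rw [this]
    intro t l
    ext ⟨j, g⟩
    rw [mem_colShift, hmemS, hmemS]
    constructor
    · rintro ⟨x', hx', hU'⟩
      obtain ⟨x, hx, rfl⟩ := List.mem_map.1 hx'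
      refine ⟨x, hx, fun y hy => (hU t y j g).1 (hU' _ ?_)⟩
      exact (dist_ambientShift_le t x y.1).trans_lt hy
    · rintro ⟨x, hx, hU'⟩
      refine ⟨_, List.mem_map_of_mem hx, fun y hy => ?_⟩
      have e : y = Multiplicative.ofAdd t • (Multiplicative.ofAdd (-t) • y) := by
        rw [smul_smul, ← ofAdd_add, add_neg_cancel, ofAdd_zero, one_smul]
      rw [e, hU]
      refine hU' _ (lt_of_le_of_lt ?_ hy)
      have h1 := dist_ambientShift_le (-t) (ambientShift t x) y.1
      have h2 : ambientShift (-t) (ambientShift t x) = x := by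
        funext v
        simp only [ambientShift_apply, smul_smul]
        simp
      rw [h2] at h1
      exact h1
  obtain ⟨s, hsgn⟩ := exists_equivariant_sign (p := p) (Y := Finset (Fin m × ZMod p)) colShift
    colShift_zero colShift_add
  refine H.false_of_label (Fact.out : p.Prime).one_lt.ne' (by omega)
    (F := {l | ∃ i, l ∈ meshFaces p n ε i}) ?_
    (fun i hi => ?_)
    (b := fun l => s (S l)) ?_ (level := fun l => (S l).card) ?_ ?_
  · rintro l ⟨i, hl⟩ l' hl'
    exact ⟨_, sublist_mem_meshFaces hl hl'⟩
  · refine Finsupp.supported_mono ?_ (hs i hi)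
    exact fun l hl => ⟨⟨i, hl⟩, hl.1⟩
  · rintro t l ⟨i, hl⟩ hl0
    simp only [hSshift]
    exact hsgn _ (colShift_one_ne (hSne hl hl0) (hSrow hl hl0)) t
  · rintro l ⟨i, hl⟩ hl0
    refine ⟨(hSne hl hl0).card_pos, (card_le_of_row (hSrow hl hl0)).trans_lt ?_⟩
    rwa [Fintype.card_fin]
  · rintro l ⟨i, hl⟩ l' - hl'
    have hsub : S l' ⊆ S l := fun v hv => by
      obtain ⟨x, hx, h⟩ := (hmemS l' v).1 hv
      exact (hmemS l v).2 ⟨x, hl'.subset hx, h⟩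
    refine ⟨Finset.card_le_card hsub, fun h => ?_⟩
    simp only [Finset.eq_of_subset_of_card_le hsub h.ge]

end JoinRealization

/-! ### Restricting equivariant maps to smaller joins. -/

section JoinInclusion

variable {p n n' : ℕ}

/-- The inclusion of a join into a join with more factors. -/
def joinInclusion (p : ℕ) (h : n' ≤ n) : C(JoinSpace p n', JoinSpace p n) where
  toFun x := ⟨fun v => if hv : v.level.val < n' then x.1 ⟨⟨v.level, hv⟩, v.elt⟩ else 0, by
    obtain ⟨h0, s, ⟨hne, hs⟩, hsupp, hsum⟩ := x.2
    let ι : JoinVertex (Multiplicative (ZMod p)) n' ↪ JoinVertex (Multiplicative (ZMod p)) n :=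
      ⟨fun v => ⟨Fin.castLE h v.level, v.elt⟩, fun v w hvw => by
        rw [JoinVertex.mk.injEq] at hvw
        cases v; cases w
        rw [JoinVertex.mk.injEq]
        exact ⟨Fin.castLE_injective h hvw.1, hvw.2⟩⟩
    refine ⟨fun v => ?_, s.map ι, ⟨hne.map, fun v hv w hw hvw => ?_⟩, fun v hv => ?_, ?_⟩
    · dsimp only
      split_ifs
      · exact h0 _
      · exact le_rfl
    · obtain ⟨v, hv', rfl⟩ := Finset.mem_map.1 hv
      obtain ⟨w, hw', rfl⟩ := Finset.mem_map.1 hw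
      rw [hs v hv' w hw' (Fin.castLE_injective h hvw)]
    · dsimp only
      split_ifs with hlt
      · exact hsupp _ fun hmem => hv (Finset.mem_map.2 ⟨_, hmem, rfl⟩)
      · rfl
    · rw [Finset.sum_map, ← hsum]
      refine Finset.sum_congr rfl fun v _ => ?_
      exact dif_pos v.level.2⟩
  continuous_toFun := by
    refine Continuous.subtype_mk (continuous_pi fun v => ?_) _
    split_ifs
    · exact (continuous_apply _).comp continuous_subtype_val
    · exact continuous_const

theorem joinInclusion_smul (h : n' ≤ n) (g : Multiplicative (ZMod p)) (x : JoinSpace p n') :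
    joinInclusion p h (g • x) = g • joinInclusion p h x := rfl

end JoinInclusion

/-! ### From equivariant maps to chromatic bounds. -/

section BEdge

variable {p : ℕ} {α β : Type*} {H : Hypergraph α} {H₁ : Hypergraph α}
  {H₂ : Hypergraph β}

/-- The weight of a tuple of vertices of `H` at a point of the Alon–Frankl–Lovász complex. -/
def tupleWeight (x : (bEdge p H).Space) (u : ZMod p → V(H)) : ℝ := x.1 ⟨fun i => (u i).1⟩

theorem continuous_tupleWeight (u : ZMod p → V(H)) :
    Continuous fun x : (bEdge p H).Space => tupleWeight x u :=
  (continuous_apply _).comp continuous_subtype_val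

/-- All tuples of nonzero weight lie in one face, whose definition allows the `i`-th entry to be
taken from a different tuple for each `i`. -/
theorem range_mem_edgeSet (x : (bEdge p H).Space) (U : ZMod p → ZMod p → V(H))
    (hU : ∀ i, tupleWeight x (U i) ≠ 0) : (Set.range fun i => (U i i).1) ∈ E(H) := by
  obtain ⟨-, s, ⟨-, -, -, hs⟩, hsupp, -⟩ := x.2
  refine hs _ fun i => ⟨⟨fun k => (U i k).1⟩, ?_, rfl⟩
  by_contra h
  exact hU i (hsupp _ h)

variable [Fact p.Prime]

theorem sum_tupleWeight [Fintype V(H)] (x : (bEdge p H).Space) : ∑ u, tupleWeight x u = 1 := by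
  classical
  obtain ⟨-, s, ⟨-, hs, -⟩, hsupp, hsum⟩ := x.2
  let ι : (ZMod p → V(H)) ↪ Tuple p α :=
    ⟨fun u => ⟨fun i => (u i).1⟩, fun u w h => funext fun i =>
      Subtype.ext (congrFun (congrArg Tuple.coord h) i)⟩
  have h1 : ∑ u, tupleWeight x u = ∑ t ∈ Finset.univ.map ι, x.1 t := by
    rw [Finset.sum_map]
    rfl
  rw [h1, ← hsum]
  refine (Finset.sum_subset (fun t ht => ?_) fun t _ ht => hsupp t ht).symm
  refine Finset.mem_map.2 ⟨fun i => ⟨t.coord i, ?_⟩, Finset.mem_univ _, rfl⟩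
  exact H.subset_vertexSet_of_mem_edgeSet' (hs t ht) (Set.mem_range_self i)

theorem tupleWeight_smul (t : ZMod p) (x : (bEdge p H).Space) (u : ZMod p → V(H)) :
    tupleWeight (Multiplicative.ofAdd t • x) u = tupleWeight x fun i => u (i - t) := by
  refine congrArg x.1 (congrArg Tuple.mk (funext fun i => ?_))
  change (u (i + -t)).1 = (u (i - t)).1
  rw [sub_eq_add_neg]

/-- Equivariant maps from a join of copies of `ℤ/p` to the Alon–Frankl–Lovász complexes of two
hypergraphs bound the number of colors in a coloring of the product. -/
theorem le_of_colorable_prod {n m : ℕ} (hV₁ : V(H₁).Finite) (hV₂ : V(H₂).Finite)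
    (f₁ : C(JoinSpace p n, (bEdge p H₁).Space)) (hf₁ : ∀ (g : Multiplicative (ZMod p)) x, f₁ (g • x) = g • f₁ x)
    (f₂ : C(JoinSpace p n, (bEdge p H₂).Space)) (hf₂ : ∀ (g : Multiplicative (ZMod p)) x, f₂ (g • x) = g • f₂ x)
    (h : (H₁.prod H₂).Colorable (m + 1)) : n ≤ m * (p - 1) := by
  classical
  have := hV₁.fintype
  have := hV₂.fintype
  obtain ⟨c, hc⟩ := h.exists_total (Nat.succ_pos m)
  have hsum : ∀ x, ∑ u, ∑ v, tupleWeight (f₁ x) u * tupleWeight (f₂ x) v = 1 := fun x => by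
    simp_rw [← Finset.mul_sum, sum_tupleWeight, mul_one]
    exact sum_tupleWeight _
  -- The index `-i` turns the shift of tuple coordinates into the column shift `i ↦ i - t` required
  -- by `le_of_equivariant_matrix`.
  let M : JoinSpace p n → Fin (m + 1) → ZMod p → ℝ := fun x j i =>
    ∑ u, ∑ v, if c ((u (-i)).1, (v (-i)).1) = j then
      tupleWeight (f₁ x) u * tupleWeight (f₂ x) v else 0
  have hcol : ∀ x i, ∑ j, M x j i = 1 := by
    intro x i
    rw [← hsum x]
    simp only [M]
    rw [Finset.sum_comm]
    refine Finset.sum_congr rfl fun u _ => ?_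
    rw [Finset.sum_comm]
    refine Finset.sum_congr rfl fun v _ => ?_
    simp
  refine le_of_equivariant_matrix M (fun j i => ?_) ?_ hcol ?_
  · refine continuous_finsetSum _ fun u _ => continuous_finsetSum _ fun v _ => ?_
    split_ifs
    · exact ((continuous_tupleWeight u).comp f₁.continuous).mul
        ((continuous_tupleWeight v).comp f₂.continuous)
    · exact continuous_const
  · intro t x j i
    simp only [M, hf₁, hf₂, tupleWeight_smul]
    rw [← Equiv.sum_comp ((Equiv.addRight t).arrowCongr (Equiv.refl V(H₁)))
      fun u => ∑ v, if c ((u (-(i - t))).1, (v (-(i - t))).1) = j then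
        tupleWeight (f₁ x) u * tupleWeight (f₂ x) v else 0]
    refine Finset.sum_congr rfl fun u _ => ?_
    refine Eq.trans (Finset.sum_congr rfl fun v _ => ?_)
      (Equiv.sum_comp ((Equiv.addRight t).arrowCongr (Equiv.refl V(H₂))) _)
    have e₁ : ∀ i', ((Equiv.addRight t).arrowCongr (Equiv.refl V(H₁)) u) i' = u (i' - t) := by
      intro i'; simp [Equiv.arrowCongr, sub_eq_add_neg]
    have e₂ : ∀ i', ((Equiv.addRight t).arrowCongr (Equiv.refl V(H₂)) v) i' = v (i' - t) := by
      intro i'; simp [Equiv.arrowCongr, sub_eq_add_neg]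
    rw [funext e₁, funext e₂]
    have e₃ : -(i - t) - t = -i := by ring
    simp only [e₃]
  · intro x
    by_contra hconst
    push Not at hconst
    -- Column `0` has sum `1`, so some color occurs in it, hence in every column when the columns
    -- agree.
    obtain ⟨j, hj⟩ : ∃ j, M x j 0 ≠ 0 := by
      by_contra h0
      push Not at h0
      have := hcol x 0
      simp [h0] at this
    have hex : ∀ i, ∃ u v, tupleWeight (f₁ x) u ≠ 0 ∧ tupleWeight (f₂ x) v ≠ 0 ∧
        c ((u i).1, (v i).1) = j := by
      intro i
      have hi : M x j (-i) ≠ 0 := by rwa [hconst j (-i) 0]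
      obtain ⟨u, -, hu⟩ := Finset.exists_ne_zero_of_sum_ne_zero hi
      obtain ⟨v, -, hv⟩ := Finset.exists_ne_zero_of_sum_ne_zero hu
      rw [neg_neg] at hv
      split_ifs at hv with hcj
      · exact ⟨u, v, left_ne_zero_of_mul hv, right_ne_zero_of_mul hv, hcj⟩
      · exact absurd rfl hv
    choose U V hU hV hUV using hex
    have he : Set.range (fun i => ((U i i).1, (V i i).1)) ∈ E(H₁.prod H₂) := by
      constructor
      · rw [← Set.range_comp]
        exact range_mem_edgeSet _ U hU
      · rw [← Set.range_comp]
        exact range_mem_edgeSet _ V hV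
    obtain ⟨_, ⟨i, rfl⟩, _, ⟨i', rfl⟩, hne⟩ := hc _ he
    exact hne ((hUV i).trans (hUV i').symm)

/-- The empty join shows that `-1` belongs to the set; applying `le_of_colorable_prod` to `H × H`
with the same map twice bounds the set above. -/
theorem isGreatest_coindBEdge (hV : V(H).Finite) (hV' : V(H).Nonempty) (hH : H.IsUniform p) :
    IsGreatest (coindSet (Multiplicative (ZMod p)) (bEdge p H).Space) (coindBEdge p H) := by
  obtain ⟨m, hm⟩ := hH.exists_colorable (Fact.out : p.Prime).two_le hV
  obtain ⟨m, rfl⟩ := Nat.exists_eq_add_of_le' (hm.pos hV')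
  have hne : (coindSet (Multiplicative (ZMod p)) (bEdge p H).Space).Nonempty := by
    have : IsEmpty (JoinSpace p 0) := ⟨fun x => by
      obtain ⟨-, s, ⟨⟨v, -⟩, -⟩, -⟩ := x.2
      exact v.level.elim0⟩
    exact ⟨_, 0, rfl, ⟨fun x => isEmptyElim x, continuous_of_const fun x => isEmptyElim x⟩,
      fun _ x => isEmptyElim x⟩
  have hbdd : BddAbove (coindSet (Multiplicative (ZMod p)) (bEdge p H).Space) := by
    refine ⟨((m * (p - 1) : ℕ) : ℤ), ?_⟩
    rintro _ ⟨n, rfl, f, hf⟩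
    have := le_of_colorable_prod hV hV f hf f hf (hm.prod_left H)
    have : (n : ℤ) ≤ (m * (p - 1) : ℕ) := Int.ofNat_le.2 this
    linarith
  exact ⟨Int.csSup_mem hne hbdd, fun k hk => le_csSup hbdd hk⟩

theorem ceil_le_chromaticNumber_prod (hV₁ : V(H₁).Finite) (hV₁' : V(H₁).Nonempty)
    (hH₁ : H₁.IsUniform p) (hV₂ : V(H₂).Finite) (hV₂' : V(H₂).Nonempty) (hH₂ : H₂.IsUniform p) :
    1 + ⌈((min (coindBEdge p H₁) (coindBEdge p H₂) : ℚ) + 1) / ((p : ℚ) - 1)⌉ ≤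
      ((H₁.prod H₂).chromaticNumber : ℤ) := by
  have hp := (Fact.out : p.Prime).two_le
  obtain ⟨m, hm⟩ := hH₁.exists_colorable hp hV₁
  have hχ := (hm.prod_left H₂).colorable_chromaticNumber
  obtain ⟨t, ht⟩ := Nat.exists_eq_add_of_le' (hχ.pos (hV₁'.prod hV₂'))
  rw [ht] at hχ ⊢
  obtain ⟨n₁, h₁, f₁, hf₁⟩ := (isGreatest_coindBEdge hV₁ hV₁' hH₁).1
  obtain ⟨n₂, h₂, f₂, hf₂⟩ := (isGreatest_coindBEdge hV₂ hV₂' hH₂).1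
  have hle := le_of_colorable_prod hV₁ hV₂
    (f₁.comp (joinInclusion p (min_le_left n₁ n₂)))
    (fun g x => by rw [ContinuousMap.comp_apply, joinInclusion_smul, hf₁, ContinuousMap.comp_apply])
    (f₂.comp (joinInclusion p (min_le_right n₁ n₂)))
    (fun g x => by rw [ContinuousMap.comp_apply, joinInclusion_smul, hf₂, ContinuousMap.comp_apply])
    hχ
  have hp' : (0 : ℚ) < (p : ℚ) - 1 := by
    have : (2 : ℚ) ≤ p := by exact_mod_cast hp
    linarith
  have hceil : ⌈((min (coindBEdge p H₁) (coindBEdge p H₂) : ℚ) + 1) / ((p : ℚ) - 1)⌉ ≤ (t : ℤ) := by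
    rw [Int.ceil_le, div_le_iff₀ hp', h₁, h₂]
    have hle' : ((min n₁ n₂ : ℕ) : ℚ) ≤ ((t * (p - 1) : ℕ) : ℚ) := Nat.cast_le.2 hle
    push_cast [Nat.cast_sub (show 1 ≤ p by omega)] at hle' ⊢
    rw [min_sub_sub_right]
    linarith
  push_cast
  linarith

end BEdge

end ListChain

theorem mainTheorem10 (p : ℕ) [Fact p.Prime] {α β : Type*} :
    -- the maxima defining the co-indices exist, and the lower bound on the product holds
    (∀ (H₁ : Hypergraph α) (H₂ : Hypergraph β),
      V(H₁).Finite → V(H₁).Nonempty → H₁.IsUniform p →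
      V(H₂).Finite → V(H₂).Nonempty → H₂.IsUniform p →
        IsGreatest (coindSet (Multiplicative (ZMod p)) (bEdge p H₁).Space) (coindBEdge p H₁) ∧
        IsGreatest (coindSet (Multiplicative (ZMod p)) (bEdge p H₂).Space) (coindBEdge p H₂) ∧
        1 + ⌈((min (coindBEdge p H₁) (coindBEdge p H₂) : ℚ) + 1) / ((p : ℚ) - 1)⌉ ≤
          ((H₁.prod H₂).chromaticNumber : ℤ)) ∧
    -- the resulting family of pairs satisfying Zhu's conjecture
    (∀ (H₁ : Hypergraph α) (H₂ : Hypergraph β),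
      V(H₁).Finite → H₁.IsUniform p → V(H₂).Finite → H₂.IsUniform p →
      (H₁.chromaticNumber : ℤ) = 1 + ⌈((coindBEdge p H₁ : ℚ) + 1) / ((p : ℚ) - 1)⌉ →
      (H₂.chromaticNumber : ℤ) = 1 + ⌈((coindBEdge p H₂ : ℚ) + 1) / ((p : ℚ) - 1)⌉ →
        (H₁.prod H₂).chromaticNumber = min H₁.chromaticNumber H₂.chromaticNumber) ∧
    -- Zhu's conjecture for pairs of Kneser hypergraphs
    (∀ n₁ k₁ n₂ k₂ : ℕ,
      ((Hypergraph.kneser p n₁ k₁).prod (Hypergraph.kneser p n₂ k₂)).chromaticNumber =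
        min (Hypergraph.kneser p n₁ k₁).chromaticNumber
          (Hypergraph.kneser p n₂ k₂).chromaticNumber) := by
  have hp := (Fact.out : p.Prime).two_le
  refine ⟨fun H₁ H₂ hV₁ hV₁' hH₁ hV₂ hV₂' hH₂ => ⟨ListChain.isGreatest_coindBEdge hV₁ hV₁' hH₁,
    ListChain.isGreatest_coindBEdge hV₂ hV₂' hH₂,
    ListChain.ceil_le_chromaticNumber_prod hV₁ hV₁' hH₁ hV₂ hV₂' hH₂⟩,
    fun H₁ H₂ hV₁ hH₁ hV₂ hH₂ h₁ h₂ => ?_, Hypergraph.chromaticNumber_prod_kneser p⟩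
  refine le_antisymm (Hypergraph.chromaticNumber_prod_le (hH₁.exists_colorable hp hV₁)
    (hH₂.exists_colorable hp hV₂)) ?_
  -- The topological bound needs nonempty vertex sets; a factor without vertices is colorable with
  -- any number of colors.
  rcases Set.eq_empty_or_nonempty V(H₁) with hV₁' | hV₁'
  · exact (min_le_left _ _).trans
      (hH₁.colorable_of_vertexSet_eq_empty (by omega) hV₁' _).chromaticNumber_le
  rcases Set.eq_empty_or_nonempty V(H₂) with hV₂' | hV₂'
  · exact (min_le_right _ _).trans
      (hH₂.colorable_of_vertexSet_eq_empty (by omega) hV₂' _).chromaticNumber_le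
  have hle := ListChain.ceil_le_chromaticNumber_prod hV₁ hV₁' hH₁ hV₂ hV₂' hH₂
  rcases le_total (coindBEdge p H₁ : ℚ) (coindBEdge p H₂ : ℚ) with h | h
  · rw [min_eq_left h, ← h₁] at hle
    exact (min_le_left _ _).trans (Int.ofNat_le.1 hle)
  · rw [min_eq_right h, ← h₂] at hle
    exact (min_le_right _ _).trans (Int.ofNat_le.1 hle)
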